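/- Let $S_\infty$ be the group of permutations of $\{1,2,\dots\}$ moving finitely many points, and let $\ell(w)$ be the number of inversions of $w$. For $w\in S_\infty$ let $1^n\times w$ be the permutation with $i\mapsto i$ for $i\le n$ and $n+i\mapsto n+w(i)$ for $i\ge 1$. Let $\mathfrak S_w(x)$ and $\mathfrak S_w(x,y)$ be the Schubert and the double Schubert polynomials: for $w\in S_N$ with longest element $w_0\in S_N$, $\mathfrak S_w(x)=\partial_{w^{-1}w_0}\big(x_1^{N-1}x_2^{N-2}\cdots x_{N-1}\big)$ and $\mathfrak S_w(x,y)=\partial_{w^{-1}w_0}\prod_{i+j\le N}(x_i-y_j)$, where the divided differences act on the $x$ variables. For a pair $p=(u,v)$ in $S_\infty\times S_\infty$ write $\mathfrak S_p=\mathfrak S_u(x)\,\mathfrak S_v(-y)$ and $1^n\times p=(1^n\times u,1^n\times v)$. Let $w_1,\dots,w_r\in S_\infty$ and $k=\ell(w_1)+\cdots+\ell(w_r)$. For every $n\ge 0$ the product of double Schubert polynomials $P_n=\prod_{t=1}^r\mathfrak S_{1^n\times w_t}(x,y)$ has a unique expansion $P_n=\sum_p c_n^p\,\mathfrak S_p$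 with integers $c_n^p$, only finitely many of them nonzero. Let $V_0=\{p: c_0^p\ne 0\}$, and for $i\ge 1$ let $V_i$ be the set of new pairs, i.e. of the $p$ with $c_i^p\neq 0$ that are not of the form $1\times q$ with $c_{i-1}^q\ne 0$. Then the expansion has the weak stable property: 1. For every $n\ge 0$, $$P_{n+1}=\sum_{p:\,c_n^p\neq 0}c_n^p\,\mathfrak S_{1\times p}+\sum_{p\in V_{n+1}}c_{n+1}^p\,\mathfrak S_p,$$ and every $(u,v)\in V_{n+1}$ satisfies $u(1)\ne 1$ or $v(1)\neq 1$. 2. For all $n\ge k$, $$P_n=\sum_{i=0}^{k}\ \sum_{p\in V_i}c_i^p\,\mathfrak S_{1^{n-i}\times p}.$$ -/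

import Mathlib

open MvPolynomial

/-- The group `S_∞` of permutations of `ℕ` that move only finitely many points. Positions and
values are numbered from `0`, so that `i : ℕ` stands for the letter `i + 1`; a permutation in `S_m`
is identified with its extension by fixed points. -/
def FinPerm : Subgroup (Equiv.Perm ℕ) where
  carrier := {w | {i | w i ≠ i}.Finite}
  one_mem' := by simp
  mul_mem' := by
    intro a b ha hb
    refine (Set.Finite.union ha hb).subset ?_
    intro i hi
    by_contra h
    simp only [Set.mem_union, Set.mem_ofPred_eq, not_or, not_not] at h
    apply hi
    rw [Equiv.Perm.mul_apply, h.2, h.1]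
  inv_mem' := by
    intro a ha
    refine Set.Finite.subset ha ?_
    intro i hi h
    apply hi
    rw [Equiv.Perm.inv_eq_iff_eq]
    exact h.symm

namespace FinPerm

/-- The simple transposition exchanging positions `i` and `i + 1`. -/
def simple (i : ℕ) : FinPerm :=
  ⟨Equiv.swap i (i + 1), (Set.toFinite {i, i + 1}).subset (by
    intro j hj
    by_contra h
    simp only [Set.mem_insert_iff, Set.mem_singleton_iff, not_or] at h
    exact hj (Equiv.swap_apply_of_ne_of_ne h.1 h.2))⟩

/-- The set of inversions of `w`. -/
def inversions (w : FinPerm) : Set (ℕ × ℕ) := {p | p.1 < p.2 ∧ w.1 p.2 < w.1 p.1}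

/-- The length `ℓ(w)`: the number of inversions. -/
noncomputable def length (w : FinPerm) : ℕ := (inversions w).ncard

/-- `w ∈ S_N` for some `N`. -/
theorem exists_bound (w : FinPerm) : ∃ N : ℕ, ∀ i, N ≤ i → w.1 i = i := by
  obtain ⟨N, hN⟩ := w.2.bddAbove
  refine ⟨N + 1, fun i hi => ?_⟩
  by_contra h
  have := hN h
  omega

open Classical in
/-- The least `N` with `w ∈ S_N`. -/
noncomputable def bound (w : FinPerm) : ℕ := Nat.find (exists_bound w)

/-- The longest element `N (N-1) ⋯ 2 1` of `S_N`. -/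
def longest (N : ℕ) : FinPerm :=
  ⟨{ toFun := fun i => if i < N then N - 1 - i else i
     invFun := fun i => if i < N then N - 1 - i else i
     left_inv := by intro i; grind
     right_inv := by intro i; grind },
   (Set.finite_lt_nat N).subset (by
    intro i hi
    by_contra h
    exact hi (if_neg h))⟩

/-- The permutation `1^n × w`: it fixes the first `n` letters and is `w`, shifted by `n`, on the
other letters. -/
def oneTimes (n : ℕ) (w : FinPerm) : FinPerm :=
  ⟨{ toFun := fun i => if i < n then i else w.1 (i - n) + n
     invFun := fun i => if i < n then i else w.1.symm (i - n) + n
     left_inv := by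
       intro i
       by_cases h : i < n
       · simp [h]
       · simp [h]; omega
     right_inv := by
       intro i
       by_cases h : i < n
       · simp [h]
       · simp [h]; omega },
   (w.2.image (· + n)).subset (by
    intro i hi
    have hn : ¬ i < n := fun h => hi (if_pos h)
    refine ⟨i - n, fun h => hi ?_, by simp; omega⟩
    show (if i < n then i else w.1 (i - n) + n) = i
    rw [if_neg hn, h]; omega)⟩

/-- `a = [a₁, …, a_p]` is a reduced word of `w`: `w = s_{a₁} ⋯ s_{a_p}` and `p = ℓ(w)`. -/
def IsReducedWord (a : List ℕ) (w : FinPerm) : Prop :=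
  (a.map simple).prod = w ∧ a.length = length w

theorem inversions_finite (w : FinPerm) : (inversions w).Finite := by
  obtain ⟨N, hN⟩ := exists_bound w
  refine ((Set.finite_lt_nat N).prod (Set.finite_lt_nat N)).subset ?_
  rintro ⟨i, j⟩ ⟨hij, hw⟩
  simp only at hij hw
  have hj : j < N := by
    by_contra h
    have h1 := hN j (by omega)
    have h2 : N ≤ w.1 i := by omega
    have h3 := w.1.injective (hN _ h2)
    omega
  exact ⟨show i < N by omega, hj⟩

theorem length_mul_simple (w : FinPerm) (i : ℕ) (h : w.1 (i + 1) < w.1 i) :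
    length (w * simple i) + 1 = length w := by
  have key : inversions w =
      insert (i, i + 1) (Prod.map (Equiv.swap i (i + 1)) (Equiv.swap i (i + 1)) ''
        inversions (w * simple i)) := by
    ext ⟨a, b⟩
    have hs : ∀ c, (w * simple i).1 c = w.1 (Equiv.swap i (i + 1) c) := fun c => rfl
    simp only [Set.mem_insert_iff, Set.mem_image, Prod.exists, Prod.map_apply, Prod.mk.injEq,
      inversions, Set.mem_ofPred_eq, hs]
    constructor
    · rintro ⟨hab, hw⟩
      by_cases hc : a = i ∧ b = i + 1
      · exact Or.inl hc
      · refine Or.inr ⟨Equiv.swap i (i + 1) a, Equiv.swap i (i + 1) b, ⟨?_, ?_⟩, ?_, ?_⟩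
        · simp only [Equiv.swap_apply_def]
          grind
        · simpa using hw
        · simp
        · simp
    · rintro (⟨rfl, rfl⟩ | ⟨c, d, ⟨hcd, hw⟩, rfl, rfl⟩)
      · exact ⟨by omega, h⟩
      · refine ⟨?_, hw⟩
        by_cases hc : c = i ∧ d = i + 1
        · obtain ⟨rfl, rfl⟩ := hc
          simp at hw
          omega
        · simp only [Equiv.swap_apply_def]
          grind
  have hinj : Function.Injective
      (Prod.map (Equiv.swap i (i + 1)) (Equiv.swap i (i + 1)) : ℕ × ℕ → ℕ × ℕ) :=
    (Equiv.injective _).prodMap (Equiv.injective _)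
  unfold length
  rw [key, Set.ncard_insert_of_notMem ?_ ((inversions_finite _).image _),
    Set.ncard_image_of_injective _ hinj]
  · rintro ⟨⟨c, d⟩, ⟨hcd, -⟩, hp⟩
    simp only [Prod.map_apply, Prod.mk.injEq] at hp hcd
    have h1 : c = i + 1 := by
      have := congrArg (Equiv.swap i (i + 1)) hp.1
      simpa using this
    have h2 : d = i := by
      have := congrArg (Equiv.swap i (i + 1)) hp.2
      simpa using this
    omega

theorem exists_isReducedWord (w : FinPerm) : ∃ a, IsReducedWord a w := by
  induction hl : length w using Nat.strong_induction_on generalizing w with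
  | _ l ih =>
    by_cases hd : ∃ i, w.1 (i + 1) < w.1 i
    · obtain ⟨i, hi⟩ := hd
      have h1 := length_mul_simple w i hi
      obtain ⟨a, ha, hal⟩ := ih _ (by omega) (w * simple i) rfl
      refine ⟨a ++ [i], ?_, ?_⟩
      · rw [List.map_append, List.prod_append, ha]
        apply Subtype.ext
        simp [simple, mul_assoc]
      · simp [hal, h1]
    · have hm : StrictMono w.1 := strictMono_nat_of_lt_succ fun i => by
        have h1 : w.1 i ≤ w.1 (i + 1) := by
          by_contra h
          exact hd ⟨i, by omega⟩
        have h2 : w.1 i ≠ w.1 (i + 1) := fun h => by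
          have := w.1.injective h
          omega
        omega
      have h0 : length w = 0 := by
        have : inversions w = ∅ := by
          ext ⟨a, b⟩
          simp only [inversions, Set.mem_ofPred_eq, Set.mem_empty_iff_false, iff_false, not_and]
          intro hab
          have := hm hab
          omega
        simp [length, this]
      have hw : w = 1 := by
        obtain ⟨N, hN⟩ := exists_bound w
        apply Subtype.ext
        ext i
        have hle : ∀ j, j ≤ w.1 j := fun j => hm.le_apply
        have hup : ∀ d j, w.1 j + d ≤ w.1 (j + d) := by
          intro d j
          induction d with
          | zero => simp
          | succ d ihd =>
            have := hm (show j + d < j + (d + 1) by omega)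
            omega
        have h1 := hup N i
        have h2 := hN (i + N) (by omega)
        have h3 := hle i
        show w.1 i = i
        omega
      exact ⟨[], by simp [hw], by simp [h0]⟩

/-- A reduced word of `w`. -/
noncomputable def reducedWord (w : FinPerm) : List ℕ := (exists_isReducedWord w).choose

end FinPerm

section DividedDifference

variable {σ : Type} [DecidableEq σ]

theorem X_sub_X_dvd_sub_rename_swap (a b : σ) (f : MvPolynomial σ ℤ) :
    (X a - X b : MvPolynomial σ ℤ) ∣ f - rename (Equiv.swap a b) f := by
  induction f using MvPolynomial.induction_on with
  | C r => simp
  | add p q hp hq =>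
    have : p + q - rename (Equiv.swap a b) (p + q) =
        (p - rename (Equiv.swap a b) p) + (q - rename (Equiv.swap a b) q) := by
      rw [map_add]; ring
    rw [this]
    exact dvd_add hp hq
  | mul_X p c hp =>
    have : p * X c - rename (Equiv.swap a b) (p * X c) =
        (p - rename (Equiv.swap a b) p) * X c +
          rename (Equiv.swap a b) p * (X c - X (Equiv.swap a b c)) := by
      rw [map_mul, rename_X]; ring
    rw [this]
    refine dvd_add (Dvd.dvd.mul_right hp _) (Dvd.dvd.mul_left ?_ _)
    by_cases ha : c = a
    · subst ha; simp
    · by_cases hb : c = b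
      · subst hb
        rw [Equiv.swap_apply_right]
        exact ⟨-1, by ring⟩
      · rw [Equiv.swap_apply_of_ne_of_ne ha hb]; simp

/-- The divided difference `(f - f|_{x_a ↔ x_b}) / (x_a - x_b)`, for distinct variables `a`, `b`. -/
noncomputable def divDiff (a b : σ) (f : MvPolynomial σ ℤ) : MvPolynomial σ ℤ :=
  (X_sub_X_dvd_sub_rename_swap a b f).choose

/-- `divDiff a b f` really is the quotient; for `a ≠ b` this equation determines it. -/
theorem sub_mul_divDiff (a b : σ) (f : MvPolynomial σ ℤ) :
    (X a - X b) * divDiff a b f = f - rename (Equiv.swap a b) f :=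
  (X_sub_X_dvd_sub_rename_swap a b f).choose_spec.symm

/-- The operator `∂_w = ∂_{a₁} ∘ ⋯ ∘ ∂_{a_p}` for a reduced word `a₁ ⋯ a_p` of `w` (it does not
depend on the word), where `∂_i` is the divided difference in the variables number `i` and `i + 1`
of the sequence `x` of variables. -/
noncomputable def divDiffPerm (x : ℕ → σ) (w : FinPerm) (f : MvPolynomial σ ℤ) :
    MvPolynomial σ ℤ :=
  (FinPerm.reducedWord w).foldr (fun i g => divDiff (x i) (x (i + 1)) g) f

end DividedDifference

/-- The Schubert polynomial `𝔖_w(x) = ∂_{w⁻¹w₀} (x₁^{N-1} x₂^{N-2} ⋯ x_{N-1})`, where `w ∈ S_N`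
and `w₀` is the longest element of `S_N` (it does not depend on `N`). -/
noncomputable def schubert (w : FinPerm) : MvPolynomial ℕ ℤ :=
  divDiffPerm id (w⁻¹ * FinPerm.longest (FinPerm.bound w))
    (∏ i ∈ Finset.range (FinPerm.bound w), X i ^ (FinPerm.bound w - 1 - i))

/-- The double Schubert polynomial
`𝔖_w(x, y) = ∂_{w⁻¹w₀} ∏_{i + j ≤ N} (x_i - y_j)`, where `w ∈ S_N`, `w₀` is the longest element of
`S_N`, the indices `i, j` start at `1`, and the divided differences act on the variables `x`. The
variables `x` are `X (Sum.inl i)`, the variables `y` are `X (Sum.inr j)`. -/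
noncomputable def doubleSchubert (w : FinPerm) : MvPolynomial (ℕ ⊕ ℕ) ℤ :=
  divDiffPerm Sum.inl (w⁻¹ * FinPerm.longest (FinPerm.bound w))
    (∏ i ∈ Finset.range (FinPerm.bound w), ∏ j ∈ Finset.range (FinPerm.bound w - 1 - i),
      (X (Sum.inl i) - X (Sum.inr j)))

/-- The product `𝔖_u(x) 𝔖_v(-y)` for a pair `p = (u, v)`. -/
noncomputable def schubertPair (p : FinPerm × FinPerm) : MvPolynomial (ℕ ⊕ ℕ) ℤ :=
  rename Sum.inl (schubert p.1) * aeval (fun j => -X (Sum.inr j)) (schubert p.2)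

/-- The pair `(1^n × u, 1^n × v)`. -/
def oneTimesPair (n : ℕ) (p : FinPerm × FinPerm) : FinPerm × FinPerm :=
  (FinPerm.oneTimes n p.1, FinPerm.oneTimes n p.2)

open Classical in
/-- For a sequence of coefficient families `c 0, c 1, …`, the set `V_i` of new pairs: `V_0` is the
support of `c 0`, and `V_{i+1}` consists of the pairs in the support of `c (i + 1)` that are not
`(1 × u, 1 × v)` for a pair `(u, v)` in the support of `c i`. -/
noncomputable def newPairs (c : ℕ → (FinPerm × FinPerm →₀ ℤ)) : ℕ → Finset (FinPerm × FinPerm)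
  | 0 => (c 0).support
  | i + 1 => (c (i + 1)).support \ (c i).support.image (oneTimesPair 1)

/-!
The coefficient of `𝔖_{(u, v)}` in a polynomial `F` is, up to the sign `(-1)^ℓ(v)`, the constant
term of `∂^x_u ∂^y_v F`. Setting `x_1` and `y_1` to `0` and renumbering the other variables turns
`𝔖_{1 × w}(x, y)` into `𝔖_w(x, y)` and intertwines `∂_{1 × u}` with `∂_u`, so the coefficient of
`1 × p` at stage `n + 1` is that of `p` at stage `n`.

If `F` has degree less than `n` and is symmetric in the first `n` variables, then `∂_u F = 0` unless
`u` fixes the first letter: a `u` without descents before `n` that moves the first letter has at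
least `n` inversions. As `P_n` has degree `k`, no new pairs occur for `n > k`.
-/

namespace FinPerm

section Group

theorem mul_apply (v w : FinPerm) (i : ℕ) : (v * w).1 i = v.1 (w.1 i) := rfl

theorem one_apply (i : ℕ) : (1 : FinPerm).1 i = i := rfl

theorem inv_apply_self (w : FinPerm) (i : ℕ) : (w⁻¹).1 (w.1 i) = i :=
  Equiv.symm_apply_apply w.1 i

theorem apply_inv_self (w : FinPerm) (i : ℕ) : w.1 ((w⁻¹).1 i) = i :=
  Equiv.apply_symm_apply w.1 i

theorem inv_apply_eq_self {w : FinPerm} {i : ℕ} (h : w.1 i = i) : (w⁻¹).1 i = i := by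
  conv_lhs => rw [← h]
  exact inv_apply_self w i

theorem ext_apply {v w : FinPerm} (h : ∀ i, v.1 i = w.1 i) : v = w :=
  Subtype.ext (Equiv.ext h)

theorem simple_apply (i j : ℕ) : (simple i).1 j = Equiv.swap i (i + 1) j := rfl

theorem simple_mul_simple (i : ℕ) : simple i * simple i = 1 :=
  ext_apply fun j => by simp [simple_apply]

theorem mul_simple_mul_simple (w : FinPerm) (i : ℕ) : w * simple i * simple i = w := by
  rw [mul_assoc, simple_mul_simple, mul_one]

theorem simple_mul_simple_mul (w : FinPerm) (i : ℕ) : simple i * (simple i * w) = w := by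
  rw [← mul_assoc, simple_mul_simple, one_mul]

theorem simple_inv (i : ℕ) : (simple i)⁻¹ = simple i :=
  inv_eq_of_mul_eq_one_left (simple_mul_simple i)

theorem mul_simple_apply_left (w : FinPerm) (i : ℕ) : (w * simple i).1 i = w.1 (i + 1) := by
  simp [simple_apply]

theorem mul_simple_apply_right (w : FinPerm) (i : ℕ) : (w * simple i).1 (i + 1) = w.1 i := by
  simp [simple_apply]

theorem mul_simple_apply_of_ne (w : FinPerm) {i j : ℕ} (h : j ≠ i) (h' : j ≠ i + 1) :
    (w * simple i).1 j = w.1 j := by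
  rw [mul_apply, simple_apply, Equiv.swap_apply_of_ne_of_ne h h']

theorem simple_commute {i j : ℕ} (h : i + 1 < j) : Commute (simple i) (simple j) :=
  ext_apply fun k => by
    simp only [mul_apply, simple_apply, Equiv.swap_apply_def]
    grind

theorem simple_braid (i : ℕ) :
    simple i * simple (i + 1) * simple i = simple (i + 1) * simple i * simple (i + 1) :=
  ext_apply fun k => by
    simp only [mul_apply, simple_apply, Equiv.swap_apply_def]
    grind

end Group

section Descent

/-- `i` is a (right) descent of `w`. The left descents of `w` are the descents of `w⁻¹`. -/
abbrev IsDescent (w : FinPerm) (i : ℕ) : Prop := w.1 (i + 1) < w.1 i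

theorem not_isDescent {w : FinPerm} {i : ℕ} : ¬ IsDescent w i ↔ w.1 i < w.1 (i + 1) := by
  have : w.1 i ≠ w.1 (i + 1) := w.1.injective.ne i.lt_succ_self.ne
  rw [IsDescent, not_lt]
  omega

theorem isDescent_mul_simple {w : FinPerm} {i : ℕ} :
    IsDescent (w * simple i) i ↔ ¬ IsDescent w i := by
  rw [not_isDescent, IsDescent, mul_simple_apply_left, mul_simple_apply_right]

theorem length_mul_simple_of_not_isDescent {w : FinPerm} {i : ℕ} (h : ¬ IsDescent w i) :
    length (w * simple i) = length w + 1 := by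
  rw [← length_mul_simple _ i (isDescent_mul_simple.2 h), mul_simple_mul_simple]

theorem length_mul_simple_le (w : FinPerm) (i : ℕ) : length (w * simple i) ≤ length w + 1 := by
  by_cases h : IsDescent w i
  · have := length_mul_simple w i h
    omega
  · exact (length_mul_simple_of_not_isDescent h).le

theorem length_one : length 1 = 0 := by
  have : inversions 1 = ∅ := by
    ext ⟨a, b⟩
    simp only [inversions, Set.mem_ofPred_eq, Set.mem_empty_iff_false, iff_false, one_apply]
    omega
  rw [length, this, Set.ncard_empty]

theorem length_prod_le (a : List ℕ) : length (a.map simple).prod ≤ a.length := by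
  induction a using List.reverseRecOn with
  | nil => simp [length_one]
  | append_singleton a i ih =>
    have := length_mul_simple_le (a.map simple).prod i
    simp only [List.map_append, List.prod_append, List.map_cons, List.map_nil, List.prod_singleton,
      List.length_append, List.length_singleton]
    omega

theorem length_inv (w : FinPerm) : length w⁻¹ = length w := by
  have : inversions w⁻¹ = (fun p : ℕ × ℕ => (w.1 p.2, w.1 p.1)) '' inversions w := by
    ext ⟨a, b⟩
    simp only [inversions, Set.mem_ofPred_eq, Set.mem_image, Prod.mk.injEq, Prod.exists]
    constructor
    · rintro ⟨h1, h2⟩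
      exact ⟨(w⁻¹).1 b, (w⁻¹).1 a, ⟨h2, by simpa only [apply_inv_self] using h1⟩,
        apply_inv_self w a, apply_inv_self w b⟩
    · rintro ⟨c, d, ⟨h1, h2⟩, rfl, rfl⟩
      exact ⟨h2, by simpa only [inv_apply_self] using h1⟩
  rw [length, this, Set.ncard_image_of_injective]
  · rfl
  · rintro ⟨a, b⟩ ⟨c, d⟩ h
    simp only [Prod.mk.injEq, EmbeddingLike.apply_eq_iff_eq] at h
    simp [h.1, h.2]

theorem inv_simple_mul (w : FinPerm) (i : ℕ) : (simple i * w)⁻¹ = w⁻¹ * simple i := by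
  rw [mul_inv_rev, simple_inv]

theorem length_simple_mul {w : FinPerm} {i : ℕ} (h : IsDescent w⁻¹ i) :
    length (simple i * w) + 1 = length w := by
  rw [← length_inv, inv_simple_mul, length_mul_simple _ _ h, length_inv]

theorem length_simple_mul_of_not_isDescent {w : FinPerm} {i : ℕ} (h : ¬ IsDescent w⁻¹ i) :
    length (simple i * w) = length w + 1 := by
  rw [← length_inv, inv_simple_mul, length_mul_simple_of_not_isDescent h, length_inv]

end Descent

section ReducedWord

theorem reducedWord_spec (w : FinPerm) : IsReducedWord (reducedWord w) w :=
  (exists_isReducedWord w).choose_spec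

theorem isReducedWord_nil : IsReducedWord [] 1 := ⟨rfl, length_one.symm⟩

theorem IsReducedWord.append {a : List ℕ} {w : FinPerm} (ha : IsReducedWord a w) {i : ℕ}
    (h : ¬ IsDescent w i) : IsReducedWord (a ++ [i]) (w * simple i) :=
  ⟨by simp [ha.1], by simp [ha.2, length_mul_simple_of_not_isDescent h]⟩

theorem IsReducedWord.append_of_isDescent {a : List ℕ} {w : FinPerm} {i : ℕ}
    (ha : IsReducedWord a (w * simple i)) (h : IsDescent w i) : IsReducedWord (a ++ [i]) w := by
  have := ha.append (isDescent_mul_simple.not_left.2 h)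
  rwa [mul_simple_mul_simple] at this

theorem IsReducedWord.cons {a : List ℕ} {w : FinPerm} (ha : IsReducedWord a w) {i : ℕ}
    (h : ¬ IsDescent w⁻¹ i) : IsReducedWord (i :: a) (simple i * w) :=
  ⟨by simp [ha.1], by simp [ha.2, length_simple_mul_of_not_isDescent h]⟩

theorem IsReducedWord.of_append {a : List ℕ} {w : FinPerm} {i : ℕ}
    (h : IsReducedWord (a ++ [i]) w) : IsDescent w i ∧ IsReducedWord a (w * simple i) := by
  have prod_eq : (a.map simple).prod = w * simple i := by
    rw [← h.1]
    simp [mul_assoc, simple_mul_simple]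
  have le_length : length (w * simple i) ≤ a.length := prod_eq ▸ length_prod_le a
  have length_eq : a.length + 1 = length w := by simpa using h.2
  have isDescent : IsDescent w i := by
    by_contra hd
    have := length_mul_simple_of_not_isDescent hd
    omega
  have := length_mul_simple w i isDescent
  exact ⟨isDescent, prod_eq, by omega⟩

theorem exists_isDescent {w : FinPerm} (h : w ≠ 1) : ∃ i, IsDescent w i := by
  obtain ⟨a, ha⟩ := exists_isReducedWord w
  rcases List.eq_nil_or_concat a with rfl | ⟨b, i, rfl⟩
  · exact absurd ha.1.symm h
  · rw [List.concat_eq_append] at ha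
    exact ⟨i, ha.of_append.1⟩

theorem strong_descent_induction {P : FinPerm → Prop}
    (step : ∀ w, (∀ i, IsDescent w i → P (w * simple i)) → P w) (w : FinPerm) : P w := by
  induction hl : length w using Nat.strong_induction_on generalizing w with
  | _ l ih =>
    refine step w fun i hi => ih _ ?_ _ rfl
    have := length_mul_simple w i hi
    omega

theorem descent_induction {P : FinPerm → Prop} (one : P 1)
    (descent : ∀ w i, IsDescent w i → P (w * simple i) → P w) (w : FinPerm) : P w := by
  induction w using strong_descent_induction with
  | step w ih =>
    by_cases h : w = 1
    · exact h ▸ one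
    · obtain ⟨i, hi⟩ := exists_isDescent h
      exact descent w i hi (ih i hi)

theorem exists_reduced_of_isDescent_of_isDescent_far {w : FinPerm} {i j : ℕ} (hij : i + 1 < j)
    (hi : IsDescent w i) (hj : IsDescent w j) :
    ∃ c, IsReducedWord (c ++ [j]) (w * simple i) ∧ IsReducedWord (c ++ [i]) (w * simple j) := by
  obtain ⟨c, hc⟩ := exists_isReducedWord (w * simple i * simple j)
  have hc' : IsReducedWord c (w * simple j * simple i) := by
    rwa [mul_assoc, ← (simple_commute hij).eq, ← mul_assoc]
  refine ⟨c, hc.append_of_isDescent ?_, hc'.append_of_isDescent ?_⟩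
  · rwa [IsDescent, mul_simple_apply_of_ne w (by omega) (by omega),
      mul_simple_apply_of_ne w (by omega) (by omega)]
  · rwa [IsDescent, mul_simple_apply_of_ne w (by omega) (by omega),
      mul_simple_apply_of_ne w (by omega) (by omega)]

theorem exists_reduced_of_isDescent_of_isDescent_succ {w : FinPerm} {i : ℕ}
    (hi : IsDescent w i) (hj : IsDescent w (i + 1)) :
    ∃ c, IsReducedWord (c ++ [i] ++ [i + 1]) (w * simple i) ∧
      IsReducedWord (c ++ [i + 1] ++ [i]) (w * simple (i + 1)) := by
  obtain ⟨c, hc⟩ := exists_isReducedWord (w * simple i * simple (i + 1) * simple i)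
  have hc' : IsReducedWord c (w * simple (i + 1) * simple i * simple (i + 1)) := by
    have braid := simple_braid i
    simp only [mul_assoc] at hc braid ⊢
    rwa [← braid]
  refine ⟨c, (hc.append_of_isDescent ?_).append_of_isDescent ?_,
    (hc'.append_of_isDescent ?_).append_of_isDescent ?_⟩ <;>
  simp only [IsDescent, mul_apply, simple_apply, Equiv.swap_apply_def] at * <;> grind

theorem exists_reduced_prod_map_mul_eq {M : Type*} [Monoid M] {f : ℕ → M}
    (commute : ∀ i j, i + 1 < j → Commute (f i) (f j))
    (braid : ∀ i, f i * f (i + 1) * f i = f (i + 1) * f i * f (i + 1))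
    {w : FinPerm} {i j : ℕ} (hij : i < j) (hi : IsDescent w i) (hj : IsDescent w j) :
    ∃ a b, IsReducedWord a (w * simple i) ∧ IsReducedWord b (w * simple j) ∧
      (a.map f).prod * f i = (b.map f).prod * f j := by
  obtain far | rfl := Nat.lt_or_eq_of_le (Nat.succ_le_of_lt hij)
  · obtain ⟨c, ha, hb⟩ := exists_reduced_of_isDescent_of_isDescent_far far hi hj
    refine ⟨_, _, ha, hb, ?_⟩
    simp [mul_assoc, (commute i j far).eq]
  · obtain ⟨c, ha, hb⟩ := exists_reduced_of_isDescent_of_isDescent_succ hi hj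
    refine ⟨_, _, ha, hb, ?_⟩
    have := braid i
    simp only [mul_assoc] at this
    simp [mul_assoc, this]

/-- Matsumoto's theorem for `S_∞`. -/
theorem IsReducedWord.prod_map_eq {M : Type*} [Monoid M] {f : ℕ → M}
    (commute : ∀ i j, i + 1 < j → Commute (f i) (f j))
    (braid : ∀ i, f i * f (i + 1) * f i = f (i + 1) * f i * f (i + 1))
    {w : FinPerm} {a b : List ℕ} (ha : IsReducedWord a w) (hb : IsReducedWord b w) :
    (a.map f).prod = (b.map f).prod := by
  induction w using strong_descent_induction generalizing a b with
  | step w ih =>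
    rcases List.eq_nil_or_concat' a with rfl | ⟨a, i, rfl⟩ <;>
      rcases List.eq_nil_or_concat' b with rfl | ⟨b, j, rfl⟩
    · rfl
    · simpa using ha.2.trans hb.2.symm
    · simpa using ha.2.trans hb.2.symm
    wlog hij : i ≤ j generalizing a b i j
    · exact (this b j hb a i ha (le_of_not_ge hij)).symm
    obtain ⟨hi, ha⟩ := ha.of_append
    obtain ⟨hj, hb⟩ := hb.of_append
    simp only [List.map_append, List.prod_append, List.map_singleton, List.prod_singleton]
    obtain rfl | hij := hij.eq_or_lt
    · rw [ih i hi ha hb]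
    · obtain ⟨a', b', ha', hb', h⟩ := exists_reduced_prod_map_mul_eq commute braid hij hi hj
      rw [ih i hi ha ha', ih j hj hb hb', h]

end ReducedWord

section Longest

theorem apply_of_bound_le {w : FinPerm} {N : ℕ} (h : bound w ≤ N) {i : ℕ} (hi : N ≤ i) :
    w.1 i = i := by
  classical
  exact Nat.find_spec (exists_bound w) i (h.trans hi)

theorem bound_le {w : FinPerm} {N : ℕ} (h : ∀ i, N ≤ i → w.1 i = i) : bound w ≤ N := by
  classical
  exact Nat.find_le h

theorem bound_one : bound 1 = 0 := Nat.le_zero.1 (bound_le fun _ _ => rfl)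

theorem bound_simple_le {i N : ℕ} (hi : i + 2 ≤ N) : bound (simple i) ≤ N :=
  bound_le fun j hj => Equiv.swap_apply_of_ne_of_ne (by omega) (by omega)

theorem bound_longest_le (N : ℕ) : bound (longest N) ≤ N :=
  bound_le fun _ hi => if_neg (by omega)

theorem bound_inv_le {w : FinPerm} {N : ℕ} (h : bound w ≤ N) : bound w⁻¹ ≤ N :=
  bound_le fun _ hi => inv_apply_eq_self (apply_of_bound_le h hi)

theorem bound_mul_le {v w : FinPerm} {N : ℕ} (hv : bound v ≤ N) (hw : bound w ≤ N) :
    bound (v * w) ≤ N :=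
  bound_le fun i hi => by rw [mul_apply, apply_of_bound_le hw hi, apply_of_bound_le hv hi]

theorem apply_lt_of_bound_le {w : FinPerm} {N : ℕ} (h : bound w ≤ N) {i : ℕ} (hi : i < N) :
    w.1 i < N := by
  by_contra hle
  have := w.1.injective (apply_of_bound_le h (not_lt.1 hle))
  omega

theorem longest_apply (N i : ℕ) : (longest N).1 i = if i < N then N - 1 - i else i := rfl

theorem longest_inv (N : ℕ) : (longest N)⁻¹ = longest N := rfl

theorem longest_zero : longest 0 = 1 := rfl

theorem simple_mul_longest {N j : ℕ} (h : j + 2 ≤ N) :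
    simple j * longest N = longest N * simple (N - 2 - j) :=
  ext_apply fun i => by
    simp only [mul_apply, longest_apply, simple_apply, Equiv.swap_apply_def]
    grind

theorem isDescent_longest_mul {w : FinPerm} {N i : ℕ} (hw : bound w ≤ N) (hi : i + 2 ≤ N) :
    IsDescent (longest N * w) i ↔ ¬ IsDescent w i := by
  have lt : w.1 i < N := apply_lt_of_bound_le hw (by omega)
  have lt_succ : w.1 (i + 1) < N := apply_lt_of_bound_le hw (by omega)
  rw [not_isDescent, IsDescent, mul_apply, mul_apply, longest_apply, longest_apply, if_pos lt,
    if_pos lt_succ]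
  omega

theorem isDescent_mul_longest {w : FinPerm} {N j : ℕ} (hj : j + 2 ≤ N) :
    IsDescent (w * longest N) (N - 2 - j) ↔ ¬ IsDescent w j := by
  rw [not_isDescent, IsDescent, mul_apply, mul_apply, longest_apply, longest_apply,
    if_pos (by omega), if_pos (by omega), show N - 1 - (N - 2 - j + 1) = j by omega,
    show N - 1 - (N - 2 - j) = j + 1 by omega]

/-- The cycle `s_{N-1} s_{N-2} ⋯ s_{N-k}`. For `k = N` it turns the longest element of `S_N` into
the one of `S_{N+1}`. -/
def descendingCycle (N : ℕ) : ℕ → FinPerm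
  | 0 => 1
  | k + 1 => descendingCycle N k * simple (N - 1 - k)

theorem descendingCycle_apply {N k : ℕ} (h : k ≤ N) (j : ℕ) :
    (descendingCycle N k).1 j =
      if j < N - k then j else if j = N - k then N else if j ≤ N then j - 1 else j := by
  induction k generalizing j with
  | zero =>
    rw [descendingCycle, one_apply]
    grind
  | succ k ih =>
    rw [descendingCycle, mul_apply, simple_apply, ih (by omega), Equiv.swap_apply_def]
    grind

theorem longest_mul_descendingCycle (N : ℕ) :
    longest N * descendingCycle N N = longest (N + 1) :=
  ext_apply fun j => by
    rw [mul_apply, descendingCycle_apply le_rfl, longest_apply, longest_apply]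
    grind

theorem not_isDescent_mul_descendingCycle {v : FinPerm} {N k : ℕ} (hv : bound v ≤ N) (hk : k < N) :
    ¬ IsDescent (v * descendingCycle N k) (N - 1 - k) := by
  have : v.1 (N - 1 - k) < N := apply_lt_of_bound_le hv (by omega)
  rwa [not_isDescent, mul_apply, mul_apply, descendingCycle_apply hk.le,
    descendingCycle_apply hk.le, if_pos (by omega), if_neg (by omega), if_pos (by omega),
    apply_of_bound_le hv le_rfl]

end Longest

section OneTimes

theorem oneTimes_apply (n : ℕ) (w : FinPerm) (i : ℕ) :
    (oneTimes n w).1 i = if i < n then i else w.1 (i - n) + n := rfl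

theorem oneTimes_apply_of_lt (w : FinPerm) {n i : ℕ} (h : i < n) : (oneTimes n w).1 i = i :=
  if_pos h

theorem oneTimes_apply_add (n : ℕ) (w : FinPerm) (i : ℕ) :
    (oneTimes n w).1 (n + i) = n + w.1 i := by
  rw [oneTimes_apply, if_neg (by omega), Nat.add_sub_cancel_left, add_comm]

theorem oneTimes_inv (n : ℕ) (w : FinPerm) : (oneTimes n w)⁻¹ = oneTimes n w⁻¹ := rfl

theorem oneTimes_mul (n : ℕ) (v w : FinPerm) :
    oneTimes n (v * w) = oneTimes n v * oneTimes n w :=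
  ext_apply fun i => by
    simp only [mul_apply, oneTimes_apply]
    by_cases h : i < n <;> simp [h]

theorem oneTimes_one (n : ℕ) : oneTimes n 1 = 1 :=
  ext_apply fun i => by
    simp only [one_apply, oneTimes_apply]
    grind

theorem oneTimes_simple (n i : ℕ) : oneTimes n (simple i) = simple (n + i) :=
  ext_apply fun j => by
    simp only [simple_apply, oneTimes_apply, Equiv.swap_apply_def]
    grind

theorem oneTimes_zero (w : FinPerm) : oneTimes 0 w = w :=
  ext_apply fun i => by simp [oneTimes_apply]

theorem oneTimes_oneTimes (m n : ℕ) (w : FinPerm) :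
    oneTimes m (oneTimes n w) = oneTimes (m + n) w :=
  ext_apply fun i => by
    simp only [oneTimes_apply]
    grind

theorem oneTimes_injective (n : ℕ) : Function.Injective (oneTimes n) := fun v w h =>
  ext_apply fun i => by
    have := congrArg (fun u : FinPerm => u.1 (n + i)) h
    simpa [oneTimes_apply_add] using this

theorem oneTimes_eq_one_iff {n : ℕ} {w : FinPerm} : oneTimes n w = 1 ↔ w = 1 := by
  simpa only [oneTimes_one] using (oneTimes_injective n).eq_iff (a := w) (b := 1)

theorem isDescent_oneTimes_add {n : ℕ} {w : FinPerm} {i : ℕ} :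
    IsDescent (oneTimes n w) (n + i) ↔ IsDescent w i := by
  rw [IsDescent, add_assoc, oneTimes_apply_add, oneTimes_apply_add, add_lt_add_iff_left]

theorem not_isDescent_oneTimes {n : ℕ} (w : FinPerm) {i : ℕ} (h : i + 1 < n) :
    ¬ IsDescent (oneTimes n w) i := by
  rw [not_isDescent, oneTimes_apply_of_lt w h, oneTimes_apply_of_lt w (by omega)]
  exact i.lt_succ_self

theorem length_oneTimes (n : ℕ) (w : FinPerm) : length (oneTimes n w) = length w := by
  induction w using descent_induction with
  | one => rw [oneTimes_one]
  | descent w i hi ih =>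
    rw [← length_mul_simple w i hi, ← length_mul_simple _ _ (isDescent_oneTimes_add.2 hi),
      ← oneTimes_simple, ← oneTimes_mul, ih]

theorem exists_eq_oneTimes_one {w : FinPerm} (h : w.1 0 = 0) : ∃ v, w = oneTimes 1 v := by
  have sub_add_cancel : ∀ u : FinPerm, u.1 0 = 0 → ∀ i, u.1 (i + 1) - 1 + 1 = u.1 (i + 1) :=
    fun u hu i => Nat.sub_add_cancel
      (Nat.one_le_iff_ne_zero.2 fun h0 => by simpa using u.1.injective (h0.trans hu.symm))
  refine ⟨⟨⟨fun i => w.1 (i + 1) - 1, fun i => (w⁻¹).1 (i + 1) - 1, fun i => ?_, fun i => ?_⟩, ?_⟩,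
    ext_apply fun i => ?_⟩
  · simp only [sub_add_cancel w h, inv_apply_self, Nat.add_sub_cancel]
  · simp only [sub_add_cancel w⁻¹ (inv_apply_eq_self h), apply_inv_self, Nat.add_sub_cancel]
  · obtain ⟨N, hN⟩ := exists_bound w
    refine (Set.finite_lt_nat N).subset fun i hi => Set.mem_ofPred.2 (lt_of_not_ge fun hle => hi ?_)
    change w.1 (i + 1) - 1 = i
    rw [hN (i + 1) (by omega), Nat.add_sub_cancel]
  · cases i with
    | zero => exact h
    | succ i => exact (sub_add_cancel w h i).symm

/-- The first `n` letters all have positive images, so the letter sent to the first one comes after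
them and forms an inversion with each of them. -/
theorem le_length_of_forall_not_isDescent {w : FinPerm} {n : ℕ}
    (h : ∀ i, i + 1 < n → ¬ IsDescent w i) (h0 : w.1 0 ≠ 0) : n ≤ length w := by
  have pos : ∀ i, i < n → 0 < w.1 i := by
    intro i hi
    induction i with
    | zero => exact Nat.pos_of_ne_zero h0
    | succ i ih => exact (ih (by omega)).trans (not_isDescent.1 (h i hi))
  have apply_eq_zero : w.1 ((w⁻¹).1 0) = 0 := apply_inv_self w 0
  have subset : (fun i => (i, (w⁻¹).1 0)) '' (Finset.range n : Set ℕ) ⊆ inversions w := by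
    rintro _ ⟨i, hi, rfl⟩
    have hi' : i < n := by simpa using hi
    refine ⟨?_, by simpa only [apply_eq_zero] using pos i hi'⟩
    by_contra hle
    have := pos ((w⁻¹).1 0) (by simp only at hle; omega)
    omega
  have := Set.ncard_le_ncard subset (inversions_finite w)
  rwa [Set.ncard_image_of_injective _ (fun a b hab => (Prod.mk.inj hab).1),
    Set.ncard_coe_finset, Finset.card_range] at this

end OneTimes

end FinPerm

section Polynomial

variable {σ τ R : Type*} [CommRing R]

theorem X_sub_X_ne_zero [Nontrivial R] {a b : σ} (h : a ≠ b) :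
    (X a - X b : MvPolynomial σ R) ≠ 0 :=
  sub_ne_zero.2 fun hab => h (X_injective hab)

theorem isHomogeneous_X_sub_X (a b : σ) : (X a - X b : MvPolynomial σ R).IsHomogeneous 1 :=
  (isHomogeneous_X R a).sub (isHomogeneous_X R b)

theorem constantCoeff_killCompl {f : σ → τ} (hf : Function.Injective f) (F : MvPolynomial τ R) :
    constantCoeff (killCompl hf F) = constantCoeff F := by
  rw [constantCoeff_eq, constantCoeff_eq, coeff_killCompl, Finsupp.mapDomain_zero]

attribute [local instance] MvPolynomial.gradedAlgebra in
theorem homogeneousComponent_add_mul {L : MvPolynomial σ R} {d : ℕ} (hL : L.IsHomogeneous d)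
    (f : MvPolynomial σ R) (n : ℕ) :
    homogeneousComponent (d + n) (L * f) = L * homogeneousComponent n f := by
  rw [← decomposition.decompose'_apply, ← decomposition.decompose'_apply]
  exact DirectSum.coe_decompose_mul_add_of_left_mem (homogeneousSubmodule σ R) hL

theorem isHomogeneous_of_isHomogeneous_mul [IsDomain R] {L f : MvPolynomial σ R} {d n : ℕ}
    (hL : L.IsHomogeneous d) (h0 : L ≠ 0) (hLf : (L * f).IsHomogeneous (d + n)) :
    f.IsHomogeneous n := by
  have component_eq_zero : ∀ m, m ≠ n → homogeneousComponent m f = 0 := fun m hm => by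
    have := homogeneousComponent_add_mul hL f m
    rw [homogeneousComponent_of_mem hLf, if_neg (by omega)] at this
    exact (mul_eq_zero.1 this.symm).resolve_left h0
  intro m hm
  by_contra h
  have := congrArg (coeff m) (component_eq_zero _ h)
  rw [coeff_homogeneousComponent, Finsupp.degree_eq_weight_one, coeff_zero] at this
  exact hm ((if_pos rfl).symm.trans this)

end Polynomial

section DividedDifference

variable {σ τ : Type} [DecidableEq σ] [DecidableEq τ] {a b c : σ}

theorem divDiff_eq_of_mul_eq (h : a ≠ b) {f g : MvPolynomial σ ℤ}
    (hg : (X a - X b) * g = f - rename (Equiv.swap a b) f) : divDiff a b f = g :=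
  mul_left_cancel₀ (X_sub_X_ne_zero h) ((sub_mul_divDiff a b f).trans hg.symm)

/-- The divided difference in two distinct variables, as a linear endomorphism. -/
noncomputable def divDiffEnd (h : a ≠ b) : Module.End ℤ (MvPolynomial σ ℤ) where
  toFun := divDiff a b
  map_add' f g := divDiff_eq_of_mul_eq h (by
    rw [mul_add, sub_mul_divDiff, sub_mul_divDiff, map_add]
    ring)
  map_smul' r f := divDiff_eq_of_mul_eq h (by
    rw [mul_smul_comm, sub_mul_divDiff, map_smul, RingHom.id_apply, smul_sub])

theorem divDiff_eq_zero_iff (h : a ≠ b) {f : MvPolynomial σ ℤ} :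
    divDiff a b f = 0 ↔ rename (Equiv.swap a b) f = f := by
  rw [← mul_eq_zero_iff_left (X_sub_X_ne_zero h), sub_mul_divDiff, sub_eq_zero, eq_comm]

theorem divDiff_swap (h : a ≠ b) (f : MvPolynomial σ ℤ) : divDiff b a f = -divDiff a b f :=
  divDiff_eq_of_mul_eq h.symm (by
    rw [Equiv.swap_comm, ← sub_mul_divDiff a b f]
    ring)

theorem divDiff_mul_of_rename_eq (h : a ≠ b) {g : MvPolynomial σ ℤ}
    (hg : rename (Equiv.swap a b) g = g) (f : MvPolynomial σ ℤ) :
    divDiff a b (f * g) = divDiff a b f * g :=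
  divDiff_eq_of_mul_eq h (by rw [← mul_assoc, sub_mul_divDiff, map_mul, hg, sub_mul])

theorem divDiff_X_sub_X_mul (h : a ≠ b) (ha : c ≠ a) (hb : c ≠ b) {g : MvPolynomial σ ℤ}
    (hg : rename (Equiv.swap a b) g = g) : divDiff a b ((X a - X c) * g) = g := by
  have : divDiff a b (X a - X c : MvPolynomial σ ℤ) = 1 := divDiff_eq_of_mul_eq h (by
    rw [map_sub, rename_X, rename_X, Equiv.swap_apply_left, Equiv.swap_apply_of_ne_of_ne ha hb]
    ring)
  rw [divDiff_mul_of_rename_eq h hg, this, one_mul]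

theorem rename_divDiff_self (h : a ≠ b) (f : MvPolynomial σ ℤ) :
    rename (Equiv.swap a b) (divDiff a b f) = divDiff a b f := by
  refine (divDiff_eq_of_mul_eq h ?_).symm
  have := congrArg (rename (Equiv.swap a b)) (sub_mul_divDiff a b f)
  simp only [map_mul, map_sub, rename_X, Equiv.swap_apply_left, Equiv.swap_apply_right,
    rename_rename, ← Equiv.coe_trans, Equiv.swap_swap, Equiv.coe_refl, rename_id_apply] at this
  linear_combination -this

theorem divDiff_divDiff_self (h : a ≠ b) (f : MvPolynomial σ ℤ) :
    divDiff a b (divDiff a b f) = 0 :=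
  (divDiff_eq_zero_iff h).2 (rename_divDiff_self h f)

theorem divDiff_algHom {c d : τ} (h : c ≠ d) (φ : MvPolynomial σ ℤ →ₐ[ℤ] MvPolynomial τ ℤ)
    {e : MvPolynomial τ ℤ} (map_sub : φ (X a) - φ (X b) = e * (X c - X d))
    (map_swap : ∀ i, φ (X (Equiv.swap a b i)) = rename (Equiv.swap c d) (φ (X i)))
    (f : MvPolynomial σ ℤ) : divDiff c d (φ f) = e * φ (divDiff a b f) := by
  have comp_eq : φ.comp (rename (Equiv.swap a b)) = (rename (Equiv.swap c d)).comp φ :=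
    algHom_ext fun i => by simpa using map_swap i
  refine divDiff_eq_of_mul_eq h ?_
  have := congrArg φ (sub_mul_divDiff a b f)
  have map_rename : φ (rename (Equiv.swap a b) f) = rename (Equiv.swap c d) (φ f) :=
    DFunLike.congr_fun comp_eq f
  rw [map_mul, _root_.map_sub, map_sub, _root_.map_sub, map_rename] at this
  linear_combination this

theorem divDiff_rename {f : σ → τ} (hf : Function.Injective f) (h : a ≠ b)
    (F : MvPolynomial σ ℤ) : divDiff (f a) (f b) (rename f F) = rename f (divDiff a b F) := by
  rw [divDiff_algHom (hf.ne h) (rename f) (a := a) (b := b) (e := 1), one_mul]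
  · simp
  · simp [hf.swap_apply]

theorem divDiff_killCompl {f : σ → τ} (hf : Function.Injective f) (h : a ≠ b)
    (F : MvPolynomial τ ℤ) :
    divDiff a b (killCompl hf F) = killCompl hf (divDiff (f a) (f b) F) := by
  have killCompl_X : ∀ i, killCompl hf (X (f i) : MvPolynomial τ ℤ) = X i := fun i => by
    rw [← rename_X, killCompl_rename_app]
  rw [divDiff_algHom h (killCompl hf) (a := f a) (b := f b) (e := 1), one_mul]
  · rw [killCompl_X, killCompl_X, one_mul]
  · intro i
    by_cases hi : i ∈ Set.range f
    · obtain ⟨i, rfl⟩ := hi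
      rw [hf.swap_apply, killCompl_X, killCompl_X, rename_X]
    · rw [Equiv.swap_apply_of_ne_of_ne (by rintro rfl; exact hi ⟨_, rfl⟩)
        (by rintro rfl; exact hi ⟨_, rfl⟩)]
      simp [killCompl, hi]

theorem divDiff_aeval_neg_X {f : σ → τ} (hf : Function.Injective f) (h : a ≠ b)
    (F : MvPolynomial σ ℤ) :
    divDiff (f a) (f b) (aeval (fun i => -X (f i)) F) =
      -aeval (fun i => -X (f i) : σ → MvPolynomial τ ℤ) (divDiff a b F) := by
  rw [divDiff_algHom (hf.ne h) (aeval fun i => -X (f i)) (a := a) (b := b) (e := -1), neg_one_mul]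
  · simp only [aeval_X]
    ring
  · simp [hf.swap_apply]

theorem divDiff_comm {d : σ} (hab : a ≠ b) (hcd : c ≠ d) (hac : a ≠ c) (had : a ≠ d)
    (hbc : b ≠ c) (hbd : b ≠ d) (f : MvPolynomial σ ℤ) :
    divDiff a b (divDiff c d f) = divDiff c d (divDiff a b f) := by
  refine divDiff_eq_of_mul_eq hab ?_
  have rename_divDiff : rename (Equiv.swap a b) (divDiff c d f) =
      divDiff c d (rename (Equiv.swap a b) f) := by
    have := divDiff_rename (Equiv.swap a b).injective hcd f
    rw [Equiv.swap_apply_of_ne_of_ne hac.symm hbc.symm,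
      Equiv.swap_apply_of_ne_of_ne had.symm hbd.symm] at this
    exact this.symm
  have invariant : rename (Equiv.swap c d) (X a - X b : MvPolynomial σ ℤ) = X a - X b := by
    simp only [map_sub, rename_X, Equiv.swap_apply_of_ne_of_ne hac had,
      Equiv.swap_apply_of_ne_of_ne hbc hbd]
  rw [rename_divDiff, mul_comm, ← divDiff_mul_of_rename_eq hcd invariant, mul_comm,
    sub_mul_divDiff]
  exact map_sub (divDiffEnd hcd) _ _

theorem mul_divDiff_divDiff_divDiff (hab : a ≠ b) (hac : a ≠ c) (hbc : b ≠ c)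
    (f : MvPolynomial σ ℤ) :
    (X a - X b) * (X a - X c) * (X b - X c) * divDiff a b (divDiff b c (divDiff a b f)) =
      f - rename (Equiv.swap a b) f - rename (Equiv.swap b c) f +
        rename (Equiv.swap b c) (rename (Equiv.swap a b) f) +
        rename (Equiv.swap a b) (rename (Equiv.swap b c) f) -
        rename (Equiv.swap a b) (rename (Equiv.swap b c) (rename (Equiv.swap a b) f)) := by
  have h₁ := sub_mul_divDiff a b f
  have h₂ := sub_mul_divDiff b c (divDiff a b f)
  have h₃ := sub_mul_divDiff a b (divDiff b c (divDiff a b f))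
  have swap_h₂ := congrArg (rename (Equiv.swap a b)) h₂
  have swap_h₁ := congrArg (rename (Equiv.swap b c)) h₁
  have swap_swap_h₁ := congrArg (rename (Equiv.swap a b)) swap_h₁
  simp only [map_mul, map_sub, rename_X, Equiv.swap_apply_left, Equiv.swap_apply_right,
    Equiv.swap_apply_of_ne_of_ne hab hac, Equiv.swap_apply_of_ne_of_ne hac.symm hbc.symm,
    rename_divDiff_self hab f] at swap_h₂ swap_h₁ swap_swap_h₁
  linear_combination (X a - X c) * (X b - X c) * h₃ + (X a - X c) * h₂ - (X b - X c) * swap_h₂ + h₁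
    - swap_h₁ + swap_swap_h₁

/-- Up to sign, exchanging `a` and `c` leaves the alternating sum in `mul_divDiff_divDiff_divDiff`
unchanged. -/
theorem divDiff_braid (hab : a ≠ b) (hac : a ≠ c) (hbc : b ≠ c) (f : MvPolynomial σ ℤ) :
    divDiff a b (divDiff b c (divDiff a b f)) = divDiff b c (divDiff a b (divDiff b c f)) := by
  have left := mul_divDiff_divDiff_divDiff hab hac hbc f
  have right := mul_divDiff_divDiff_divDiff hbc.symm hac.symm hab.symm f
  have swap_conj : rename (Equiv.swap a b) (rename (Equiv.swap b c) (rename (Equiv.swap a b) f)) =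
      rename (Equiv.swap b c) (rename (Equiv.swap a b) (rename (Equiv.swap b c) f)) := by
    simp only [rename_rename]
    congr 2
    funext i
    simp only [Function.comp_apply, Equiv.swap_apply_def]
    grind
  have map_neg : divDiff a b (-divDiff b c f) = -divDiff a b (divDiff b c f) :=
    _root_.map_neg (divDiffEnd hab) _
  rw [divDiff_swap hbc, divDiff_swap hab, divDiff_swap hbc, map_neg, neg_neg, Equiv.swap_comm c b,
    Equiv.swap_comm b a] at right
  refine mul_left_cancel₀ (mul_ne_zero (mul_ne_zero (X_sub_X_ne_zero hab) (X_sub_X_ne_zero hac))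
    (X_sub_X_ne_zero hbc)) (left.trans ?_)
  rw [swap_conj]
  linear_combination -right

theorem totalDegree_divDiff_lt (h : a ≠ b) {f : MvPolynomial σ ℤ} (h0 : divDiff a b f ≠ 0) :
    (divDiff a b f).totalDegree < f.totalDegree := by
  have degree_mul := totalDegree_mul_of_isDomain (X_sub_X_ne_zero h) h0
  rw [sub_mul_divDiff, (isHomogeneous_X_sub_X a b).totalDegree (X_sub_X_ne_zero h)] at degree_mul
  have degree_sub := totalDegree_sub f (rename (Equiv.swap a b) f)
  have degree_rename := totalDegree_rename_le (Equiv.swap a b) f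
  have := max_le le_rfl degree_rename
  omega

theorem isHomogeneous_divDiff (h : a ≠ b) {f : MvPolynomial σ ℤ} {n : ℕ}
    (hf : f.IsHomogeneous n) : (divDiff a b f).IsHomogeneous (n - 1) := by
  cases n with
  | zero =>
    have : divDiff a b f = 0 := by
      by_contra h0
      have := totalDegree_divDiff_lt h h0
      have := hf.totalDegree_le
      omega
    rw [this]
    exact isHomogeneous_zero _ _ _
  | succ n =>
    refine isHomogeneous_of_isHomogeneous_mul (isHomogeneous_X_sub_X a b) (X_sub_X_ne_zero h) ?_
    rw [sub_mul_divDiff, add_comm 1]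
    exact hf.sub hf.rename_isHomogeneous

end DividedDifference

section PermDividedDifference

open FinPerm

variable {σ τ : Type} [DecidableEq σ] [DecidableEq τ] {x y : ℕ → σ} {z : ℕ → τ}
  (hx : Function.Injective x) (hy : Function.Injective y) (hz : Function.Injective z)

/-- The divided difference in the variables number `i` and `i + 1` of the sequence `x`. -/
noncomputable def adjDivDiff (i : ℕ) : Module.End ℤ (MvPolynomial σ ℤ) :=
  divDiffEnd (hx.ne i.lt_succ_self.ne)

/-- The operator `∂_w` in the variables `x`, that is `divDiffPerm x w`, as a linear endomorphism. -/
noncomputable def permDivDiff (w : FinPerm) : Module.End ℤ (MvPolynomial σ ℤ) :=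
  ((reducedWord w).map (adjDivDiff hx)).prod

theorem permDivDiff_apply (w : FinPerm) (f : MvPolynomial σ ℤ) :
    permDivDiff hx w f = divDiffPerm x w f := by
  rw [permDivDiff, divDiffPerm]
  induction reducedWord w with
  | nil => rfl
  | cons i a ih =>
    rw [List.map_cons, List.prod_cons, Module.End.mul_apply, ih]
    rfl

theorem adjDivDiff_mul_self (i : ℕ) : adjDivDiff hx i * adjDivDiff hx i = 0 :=
  LinearMap.ext (divDiff_divDiff_self (hx.ne i.lt_succ_self.ne))

theorem adjDivDiff_commute_of_ne {i j : ℕ} (h : x i ≠ y j) (h₁ : x i ≠ y (j + 1))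
    (h₂ : x (i + 1) ≠ y j) (h₃ : x (i + 1) ≠ y (j + 1)) :
    Commute (adjDivDiff hx i) (adjDivDiff hy j) :=
  LinearMap.ext (divDiff_comm (hx.ne i.lt_succ_self.ne) (hy.ne j.lt_succ_self.ne) h h₁ h₂ h₃)

theorem adjDivDiff_commute {i j : ℕ} (h : i + 1 < j) :
    Commute (adjDivDiff hx i) (adjDivDiff hx j) :=
  adjDivDiff_commute_of_ne hx hx (hx.ne (by omega)) (hx.ne (by omega)) (hx.ne (by omega))
    (hx.ne (by omega))

theorem adjDivDiff_braid (i : ℕ) :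
    adjDivDiff hx i * adjDivDiff hx (i + 1) * adjDivDiff hx i =
      adjDivDiff hx (i + 1) * adjDivDiff hx i * adjDivDiff hx (i + 1) :=
  LinearMap.ext (divDiff_braid (hx.ne (by omega)) (hx.ne (by omega)) (hx.ne (by omega)))

theorem permDivDiff_eq_of_isReducedWord {a : List ℕ} {w : FinPerm} (ha : IsReducedWord a w) :
    permDivDiff hx w = (a.map (adjDivDiff hx)).prod :=
  (reducedWord_spec w).prod_map_eq (fun _ _ => adjDivDiff_commute hx) (adjDivDiff_braid hx) ha

theorem permDivDiff_one : permDivDiff hx 1 = 1 :=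
  permDivDiff_eq_of_isReducedWord hx isReducedWord_nil

theorem permDivDiff_mul_adjDivDiff (w : FinPerm) (i : ℕ) :
    permDivDiff hx w * adjDivDiff hx i =
      if IsDescent w i then 0 else permDivDiff hx (w * simple i) := by
  have mul_of_not_isDescent : ∀ v, ¬ IsDescent v i →
      permDivDiff hx (v * simple i) = permDivDiff hx v * adjDivDiff hx i := fun v hv => by
    rw [permDivDiff_eq_of_isReducedWord hx ((reducedWord_spec v).append hv), List.map_append,
      List.prod_append, List.map_singleton, List.prod_singleton, permDivDiff]
  split_ifs with h
  · have := mul_of_not_isDescent (w * simple i) (isDescent_mul_simple.not_left.2 h)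
    rw [mul_simple_mul_simple] at this
    rw [this, mul_assoc, adjDivDiff_mul_self, mul_zero]
  · exact (mul_of_not_isDescent w h).symm

theorem permDivDiff_of_isDescent {w : FinPerm} {i : ℕ} (h : IsDescent w i)
    (f : MvPolynomial σ ℤ) :
    permDivDiff hx w f = permDivDiff hx (w * simple i) (adjDivDiff hx i f) := by
  rw [← Module.End.mul_apply, permDivDiff_mul_adjDivDiff,
    if_neg (isDescent_mul_simple.not_left.2 h), mul_simple_mul_simple]

theorem adjDivDiff_mul_permDivDiff (w : FinPerm) (i : ℕ) :
    adjDivDiff hx i * permDivDiff hx w =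
      if IsDescent w⁻¹ i then 0 else permDivDiff hx (simple i * w) := by
  have mul_of_not_isDescent : ∀ v, ¬ IsDescent v⁻¹ i →
      permDivDiff hx (simple i * v) = adjDivDiff hx i * permDivDiff hx v := fun v hv => by
    rw [permDivDiff_eq_of_isReducedWord hx ((reducedWord_spec v).cons hv), List.map_cons,
      List.prod_cons, permDivDiff]
  split_ifs with h
  · have := mul_of_not_isDescent (simple i * w)
      (by rwa [inv_simple_mul, isDescent_mul_simple, not_not])
    rw [simple_mul_simple_mul] at this
    rw [this, ← mul_assoc, adjDivDiff_mul_self, zero_mul]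
  · exact (mul_of_not_isDescent w h).symm

theorem adjDivDiff_commute_permDivDiff (h : ∀ i j, x i ≠ y j) (i : ℕ) (w : FinPerm) :
    Commute (adjDivDiff hx i) (permDivDiff hy w) :=
  Commute.list_prod_right _ _ (List.forall_mem_map.2 fun _ _ =>
    adjDivDiff_commute_of_ne hx hy (h _ _) (h _ _) (h _ _) (h _ _))

theorem permDivDiff_commute (h : ∀ i j, x i ≠ y j) (v w : FinPerm) :
    Commute (permDivDiff hx v) (permDivDiff hy w) :=
  Commute.list_prod_left _ _ (List.forall_mem_map.2 fun i _ =>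
    adjDivDiff_commute_permDivDiff hx hy h i w)

theorem permDivDiff_map_of_eq_smul {T : MvPolynomial σ ℤ → MvPolynomial τ ℤ} {e : ℤ}
    (hT : ∀ i f, adjDivDiff hz i (T f) = e • T (adjDivDiff hx i f)) (w : FinPerm)
    (f : MvPolynomial σ ℤ) :
    permDivDiff hz w (T f) = e ^ length w • T (permDivDiff hx w f) := by
  induction w using descent_induction generalizing f with
  | one => simp [permDivDiff_one, length_one]
  | descent w i hi ih =>
    rw [permDivDiff_of_isDescent hz hi, permDivDiff_of_isDescent hx hi, hT, map_smul, ih,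
      smul_smul, ← pow_succ', length_mul_simple w i hi]

theorem permDivDiff_map {T : MvPolynomial σ ℤ → MvPolynomial τ ℤ}
    (hT : ∀ i f, adjDivDiff hz i (T f) = T (adjDivDiff hx i f)) (w : FinPerm)
    (f : MvPolynomial σ ℤ) : permDivDiff hz w (T f) = T (permDivDiff hx w f) := by
  have := permDivDiff_map_of_eq_smul hx hz (e := 1) (fun i f => (hT i f).trans (one_smul _ _).symm)
    w f
  rwa [one_pow, one_smul] at this

theorem permDivDiff_comp_add (n : ℕ) (w : FinPerm) :
    permDivDiff (hx.comp (add_right_injective n)) w = permDivDiff hx (oneTimes n w) := by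
  refine LinearMap.ext fun f => ?_
  induction w using descent_induction generalizing f with
  | one => rw [oneTimes_one, permDivDiff_one, permDivDiff_one]
  | descent w i hi ih =>
    rw [permDivDiff_of_isDescent _ hi, ih, oneTimes_mul, oneTimes_simple,
      permDivDiff_of_isDescent hx (isDescent_oneTimes_add.2 hi)]
    rfl

theorem isHomogeneous_permDivDiff {f : MvPolynomial σ ℤ} {n : ℕ} (hf : f.IsHomogeneous n)
    (w : FinPerm) : (permDivDiff hx w f).IsHomogeneous (n - length w) := by
  induction w using descent_induction generalizing f n with
  | one => rwa [permDivDiff_one, length_one]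
  | descent w i hi ih =>
    rw [permDivDiff_of_isDescent hx hi, ← length_mul_simple w i hi, add_comm, ← Nat.sub_sub]
    exact ih (isHomogeneous_divDiff (hx.ne i.lt_succ_self.ne) hf)

theorem totalDegree_adjDivDiff_lt {i : ℕ} {f : MvPolynomial σ ℤ} (h : adjDivDiff hx i f ≠ 0) :
    (adjDivDiff hx i f).totalDegree < f.totalDegree :=
  totalDegree_divDiff_lt (hx.ne i.lt_succ_self.ne) h

theorem permDivDiff_eq_zero_of_totalDegree_lt {w : FinPerm} {f : MvPolynomial σ ℤ}
    (h : f.totalDegree < length w) : permDivDiff hx w f = 0 := by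
  induction w using descent_induction generalizing f with
  | one => simp [length_one] at h
  | descent w i hi ih =>
    rw [permDivDiff_of_isDescent hx hi]
    by_cases h0 : adjDivDiff hx i f = 0
    · rw [h0, map_zero]
    · have := totalDegree_adjDivDiff_lt hx h0
      have := length_mul_simple w i hi
      exact ih (by omega)

theorem permDivDiff_eq_zero_of_apply_zero_ne {w : FinPerm} (h0 : w.1 0 ≠ 0) {n : ℕ}
    {f : MvPolynomial σ ℤ} (hn : f.totalDegree < n)
    (hf : ∀ i, i + 1 < n → adjDivDiff hx i f = 0) : permDivDiff hx w f = 0 := by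
  by_cases h : ∃ i, i + 1 < n ∧ IsDescent w i
  · obtain ⟨i, hi, hd⟩ := h
    rw [permDivDiff_of_isDescent hx hd, hf i hi, map_zero]
  · simp only [not_exists, not_and] at h
    exact permDivDiff_eq_zero_of_totalDegree_lt hx
      (hn.trans_le (le_length_of_forall_not_isDescent h h0))

theorem eq_length_of_permDivDiff_eq_one {w : FinPerm} {f : MvPolynomial σ ℤ} {n : ℕ}
    (hf : f.IsHomogeneous n) (h : permDivDiff hx w f = 1) : n = length w := by
  refine le_antisymm ?_ ?_
  · have := isHomogeneous_permDivDiff hx hf w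
    rw [h] at this
    exact Nat.sub_eq_zero_iff_le.1 (this.inj_right (isHomogeneous_one _ _) one_ne_zero)
  · by_contra hlt
    have := permDivDiff_eq_zero_of_totalDegree_lt hx (hf.totalDegree_le.trans_lt (not_le.1 hlt))
    exact one_ne_zero (h.symm.trans this)

theorem adjDivDiff_prod_eq_zero {ι : Type*} {s : Finset ι} {f : ι → MvPolynomial σ ℤ} {i : ℕ}
    (h : ∀ t ∈ s, adjDivDiff hx i (f t) = 0) : adjDivDiff hx i (∏ t ∈ s, f t) = 0 := by
  have i_ne_succ := hx.ne i.lt_succ_self.ne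
  refine (divDiff_eq_zero_iff i_ne_succ).2 ((map_prod _ _ _).trans ?_)
  exact Finset.prod_congr rfl fun t ht => (divDiff_eq_zero_iff i_ne_succ).1 (h t ht)

theorem adjDivDiff_eq_zero_of_notMem_vars {i : ℕ} {f : MvPolynomial σ ℤ} (hi : x i ∉ f.vars)
    (hi' : x (i + 1) ∉ f.vars) : adjDivDiff hx i f = 0 := by
  refine (divDiff_eq_zero_iff (hx.ne i.lt_succ_self.ne)).2 ?_
  refine (hom_congr_vars (f₁ := (rename (Equiv.swap (x i) (x (i + 1)))).toRingHom)
    (f₂ := RingHom.id _) (by ext; simp) (fun c hc _ => ?_) rfl)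
  rw [AlgHom.toRingHom_eq_coe, RingHom.coe_coe, rename_X, RingHom.id_apply,
    Equiv.swap_apply_of_ne_of_ne (ne_of_mem_of_not_mem hc hi) (ne_of_mem_of_not_mem hc hi')]

theorem finite_setOf_adjDivDiff_ne_zero (f : MvPolynomial σ ℤ) :
    {i | adjDivDiff hx i f ≠ 0}.Finite := by
  have finite_preimage : ∀ {z : ℕ → σ}, Function.Injective z → (z ⁻¹' f.vars).Finite :=
    fun hz => f.vars.finite_toSet.preimage hz.injOn
  refine ((finite_preimage hx).union (finite_preimage (hx.comp Nat.succ_injective))).subset ?_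
  intro i hi
  contrapose! hi
  rw [Set.mem_union, not_or] at hi
  simpa using adjDivDiff_eq_zero_of_notMem_vars hx hi.1 hi.2

theorem finite_setOf_permDivDiff_ne_zero (f : MvPolynomial σ ℤ) :
    {w | permDivDiff hx w f ≠ 0}.Finite := by
  induction hd : f.totalDegree using Nat.strong_induction_on generalizing f with
  | _ d ih =>
    have finite_image : ∀ i ∈ {i | adjDivDiff hx i f ≠ 0},
        ((· * simple i) '' {w | permDivDiff hx w (adjDivDiff hx i f) ≠ 0}).Finite := fun i hi =>
      (ih _ (hd ▸ totalDegree_adjDivDiff_lt hx hi) _ rfl).image _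
    refine ((Set.finite_singleton 1).union
      ((finite_setOf_adjDivDiff_ne_zero hx f).biUnion finite_image)).subset fun w hw => ?_
    by_cases h1 : w = 1
    · exact Or.inl h1
    · obtain ⟨i, hi⟩ := exists_isDescent h1
      have hw' : permDivDiff hx (w * simple i) (adjDivDiff hx i f) ≠ 0 :=
        permDivDiff_of_isDescent hx hi f ▸ hw
      refine Or.inr (Set.mem_biUnion (x := i) (fun h => hw' ?_)
        ⟨w * simple i, hw', mul_simple_mul_simple w i⟩)
      rw [h, map_zero]

/-- The polynomial is symmetric in all the variables `x`, of which there are infinitely many. -/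
theorem notMem_vars_of_adjDivDiff_eq_zero {f : MvPolynomial σ ℤ}
    (h : ∀ i, adjDivDiff hx i f = 0) (i : ℕ) : x i ∉ f.vars := by
  intro hi
  have step : ∀ j, x j ∈ f.vars → x (j + 1) ∈ f.vars := by
    intro j hj
    rw [← (divDiff_eq_zero_iff (hx.ne j.lt_succ_self.ne)).1 (h j)] at hj
    obtain ⟨c, hc, hcj⟩ := mem_vars_rename _ _ hj
    rwa [Equiv.swap_apply_eq_iff.1 hcj, Equiv.swap_apply_left] at hc
  have all : ∀ j, x (i + j) ∈ f.vars := by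
    intro j
    induction j with
    | zero => exact hi
    | succ j ih => exact step _ ih
  exact Set.infinite_range_of_injective (hx.comp (add_right_injective i))
    (f.vars.finite_toSet.subset (Set.range_subset_iff.2 all))

end PermDividedDifference

section BoxProduct

/-- The product of `x_i - y_j` over a finite set of boxes `(i, j)`. -/
noncomputable def boxProd (S : Finset (ℕ × ℕ)) : MvPolynomial (ℕ ⊕ ℕ) ℤ :=
  ∏ p ∈ S, (X (Sum.inl p.1) - X (Sum.inr p.2))

theorem boxProd_insert {S : Finset (ℕ × ℕ)} {a b : ℕ} (h : (a, b) ∉ S) :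
    boxProd (insert (a, b) S) = (X (Sum.inl a) - X (Sum.inr b)) * boxProd S :=
  Finset.prod_insert h

theorem isHomogeneous_boxProd (S : Finset (ℕ × ℕ)) : (boxProd S).IsHomogeneous S.card :=
  S.card_eq_sum_ones ▸ IsHomogeneous.prod S _ _ fun _ _ => isHomogeneous_X_sub_X _ _

theorem rename_boxProd {e f : Equiv.Perm ℕ} {S : Finset (ℕ × ℕ)}
    (h : ∀ i j, (e i, f j) ∈ S ↔ (i, j) ∈ S) :
    rename (Equiv.Perm.sumCongr e f) (boxProd S) = boxProd S := by
  rw [boxProd, map_prod]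
  exact Finset.prod_equiv (e.prodCongr f) (fun p => (h p.1 p.2).symm) fun p _ => by simp

theorem adjDivDiff_inl_boxProd_insert {S : Finset (ℕ × ℕ)} {a b : ℕ} (hab : (a, b) ∉ S)
    (h : ∀ i j, (Equiv.swap a (a + 1) i, j) ∈ S ↔ (i, j) ∈ S) :
    adjDivDiff Sum.inl_injective a (boxProd (insert (a, b) S)) = boxProd S := by
  rw [boxProd_insert hab]
  refine divDiff_X_sub_X_mul (by simp) Sum.inr_ne_inl Sum.inr_ne_inl ?_
  rw [← Equiv.Perm.sumCongr_swap_refl]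
  exact rename_boxProd h

theorem adjDivDiff_inr_boxProd_insert {S : Finset (ℕ × ℕ)} {a b : ℕ} (hab : (a, b) ∉ S)
    (h : ∀ i j, (i, Equiv.swap b (b + 1) j) ∈ S ↔ (i, j) ∈ S) :
    adjDivDiff Sum.inr_injective b (boxProd (insert (a, b) S)) = -boxProd S := by
  rw [boxProd_insert hab, ← neg_sub, neg_mul, map_neg, neg_inj]
  refine divDiff_X_sub_X_mul (by simp) Sum.inl_ne_inr Sum.inl_ne_inr ?_
  rw [← Equiv.Perm.sumCongr_refl_swap]
  exact rename_boxProd h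

/-- The boxes of the staircase with rows of lengths `N, N - 1, …, 1`, where the first `m` rows are
shortened by one box. The boxes with `i + j ≤ N`, in the numbering from `1`, are `staircase N N`. -/
def staircase (N m : ℕ) : Finset (ℕ × ℕ) :=
  (Finset.range N ×ˢ Finset.range N).filter
    fun p => (p.1 < m ∧ p.1 + p.2 + 1 < N) ∨ (m ≤ p.1 ∧ p.1 + p.2 < N)

theorem mem_staircase {N m i j : ℕ} :
    (i, j) ∈ staircase N m ↔ (i < m ∧ i + j + 1 < N) ∨ (m ≤ i ∧ i + j < N) := by
  simp only [staircase, Finset.mem_filter, Finset.mem_product, Finset.mem_range]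
  omega

theorem staircase_eq_insert {N m : ℕ} (h : m < N) :
    staircase N m = insert (m, N - 1 - m) (staircase N (m + 1)) := by
  ext ⟨i, j⟩
  simp only [Finset.mem_insert, mem_staircase, Prod.mk.injEq]
  omega

theorem staircase_zero (N : ℕ) : staircase N 0 = staircase (N + 1) (N + 1) := by
  ext ⟨i, j⟩
  simp only [mem_staircase]
  omega

theorem adjDivDiff_boxProd_staircase {N m : ℕ} (h : m < N) :
    adjDivDiff Sum.inl_injective m (boxProd (staircase N m)) = boxProd (staircase N (m + 1)) := by
  rw [staircase_eq_insert h, adjDivDiff_inl_boxProd_insert]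
  · simp only [mem_staircase]
    omega
  · intro i j
    simp only [mem_staircase, Equiv.swap_apply_def]
    grind

theorem adjDivDiff_inr_boxProd_staircase {N j : ℕ} (h : j + 2 ≤ N) :
    adjDivDiff Sum.inr_injective j (boxProd (staircase N N)) =
      -adjDivDiff Sum.inl_injective (N - 2 - j) (boxProd (staircase N N)) := by
  have corner_mem : (N - 2 - j, j) ∈ staircase N N := mem_staircase.2 (by omega)
  rw [← Finset.insert_erase corner_mem, adjDivDiff_inr_boxProd_insert (Finset.notMem_erase _ _),
    adjDivDiff_inl_boxProd_insert (Finset.notMem_erase _ _)]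
  all_goals
    intro i k
    simp only [Finset.mem_erase, mem_staircase, Equiv.swap_apply_def, ne_eq, Prod.mk.injEq]
    grind

end BoxProduct

section Schubert

open FinPerm

theorem permDivDiff_mul_descendingCycle {v : FinPerm} {N k : ℕ} (hv : bound v ≤ N) (hk : k ≤ N) :
    permDivDiff Sum.inl_injective (v * descendingCycle N k) (boxProd (staircase N (N - k))) =
      permDivDiff Sum.inl_injective v (boxProd (staircase N N)) := by
  induction k with
  | zero => rw [descendingCycle, mul_one, Nat.sub_zero]
  | succ k ih =>
    have recursion := permDivDiff_mul_adjDivDiff (σ := ℕ ⊕ ℕ) Sum.inl_injective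
      (v * descendingCycle N k) (N - 1 - k)
    rw [if_neg (not_isDescent_mul_descendingCycle hv hk)] at recursion
    rw [descendingCycle, ← mul_assoc, ← recursion, Module.End.mul_apply,
      show N - (k + 1) = N - 1 - k by omega, adjDivDiff_boxProd_staircase (by omega),
      show N - 1 - k + 1 = N - k by omega]
    exact ih (by omega)

theorem doubleSchubert_eq_of_bound_le {w : FinPerm} {N : ℕ} (h : bound w ≤ N) :
    doubleSchubert w =
      permDivDiff Sum.inl_injective (w⁻¹ * longest N) (boxProd (staircase N N)) := by
  induction N, h using Nat.le_induction with
  | base =>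
    rw [doubleSchubert, boxProd, permDivDiff_apply]
    congr 1
    symm
    refine Finset.prod_finset_product _ _ _ fun ⟨i, j⟩ => ?_
    rw [mem_staircase, Finset.mem_range, Finset.mem_range]
    omega
  | succ N hN ih =>
    rw [ih, ← permDivDiff_mul_descendingCycle (bound_mul_le (bound_inv_le hN) (bound_longest_le N))
      le_rfl, mul_assoc, longest_mul_descendingCycle, Nat.sub_self, staircase_zero]

theorem adjDivDiff_inl_doubleSchubert (w : FinPerm) (i : ℕ) :
    adjDivDiff Sum.inl_injective i (doubleSchubert w) =
      if IsDescent w i then doubleSchubert (w * simple i) else 0 := by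
  obtain ⟨N, hN, hi⟩ : ∃ N, bound w ≤ N ∧ i + 2 ≤ N := ⟨_, le_max_left _ _, le_max_right _ _⟩
  rw [doubleSchubert_eq_of_bound_le hN,
    doubleSchubert_eq_of_bound_le (bound_mul_le hN (bound_simple_le hi)), ← Module.End.mul_apply,
    adjDivDiff_mul_permDivDiff, mul_inv_rev, mul_inv_rev, inv_inv, longest_inv, simple_inv,
    mul_assoc]
  simp only [isDescent_longest_mul hN hi]
  split_ifs <;> rfl

theorem adjDivDiff_inr_doubleSchubert (w : FinPerm) (j : ℕ) :
    adjDivDiff Sum.inr_injective j (doubleSchubert w) =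
      if IsDescent w⁻¹ j then -doubleSchubert (simple j * w) else 0 := by
  obtain ⟨N, hN, hj⟩ : ∃ N, bound w ≤ N ∧ j + 2 ≤ N := ⟨_, le_max_left _ _, le_max_right _ _⟩
  have commute := adjDivDiff_commute_permDivDiff Sum.inr_injective Sum.inl_injective
    (fun _ _ => Sum.inr_ne_inl) j (w⁻¹ * longest N)
  rw [doubleSchubert_eq_of_bound_le hN,
    doubleSchubert_eq_of_bound_le (bound_mul_le (bound_simple_le hj) hN), ← Module.End.mul_apply,
    commute.eq, Module.End.mul_apply, adjDivDiff_inr_boxProd_staircase hj, map_neg,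
    ← Module.End.mul_apply, permDivDiff_mul_adjDivDiff, inv_simple_mul, mul_assoc, mul_assoc,
    simple_mul_longest hj]
  simp only [isDescent_mul_longest hj]
  split_ifs <;> simp

theorem doubleSchubert_one : doubleSchubert 1 = 1 := by
  rw [doubleSchubert_eq_of_bound_le bound_one.le, longest_zero, inv_one, mul_one, permDivDiff_one]
  rfl

theorem permDivDiff_doubleSchubert_self (w : FinPerm) :
    permDivDiff Sum.inl_injective w (doubleSchubert w) = 1 := by
  induction w using descent_induction with
  | one => rw [permDivDiff_one, doubleSchubert_one, Module.End.one_apply]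
  | descent w i hi ih =>
    rw [permDivDiff_of_isDescent _ hi, adjDivDiff_inl_doubleSchubert, if_pos hi, ih]

theorem isHomogeneous_doubleSchubert (w : FinPerm) :
    (doubleSchubert w).IsHomogeneous (length w) := by
  obtain ⟨m, hm⟩ : ∃ m, (doubleSchubert w).IsHomogeneous m :=
    ⟨_, doubleSchubert_eq_of_bound_le (w := w) le_rfl ▸
      isHomogeneous_permDivDiff Sum.inl_injective (isHomogeneous_boxProd _) _⟩
  rwa [← eq_length_of_permDivDiff_eq_one Sum.inl_injective hm (permDivDiff_doubleSchubert_self w)]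

open Classical in
theorem constantCoeff_doubleSchubert (w : FinPerm) :
    constantCoeff (doubleSchubert w) = if w = 1 then 1 else 0 := by
  split_ifs with h
  · rw [h, doubleSchubert_one, map_one]
  · obtain ⟨i, hi⟩ := exists_isDescent h
    have := length_mul_simple w i hi
    exact (isHomogeneous_doubleSchubert w).coeff_eq_zero (by rw [map_zero]; omega)

theorem schubert_eq_killCompl (w : FinPerm) :
    schubert w = killCompl Sum.inl_injective (doubleSchubert w) := by
  have specialization := permDivDiff_map (σ := ℕ ⊕ ℕ) Sum.inl_injective Function.injective_id
    (T := killCompl Sum.inl_injective)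
    fun i f => divDiff_killCompl Sum.inl_injective i.lt_succ_self.ne f
  rw [doubleSchubert, ← permDivDiff_apply Sum.inl_injective, ← specialization, permDivDiff_apply,
    schubert]
  simp [killCompl, map_prod]

theorem adjDivDiff_schubert (w : FinPerm) (i : ℕ) :
    adjDivDiff Function.injective_id i (schubert w) =
      if IsDescent w i then schubert (w * simple i) else 0 := by
  rw [schubert_eq_killCompl, schubert_eq_killCompl, ← map_zero (killCompl Sum.inl_injective),
    ← apply_ite, ← adjDivDiff_inl_doubleSchubert]
  exact divDiff_killCompl Sum.inl_injective i.lt_succ_self.ne _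

open Classical in
theorem constantCoeff_permDivDiff_schubert (v w : FinPerm) :
    constantCoeff (permDivDiff Function.injective_id v (schubert w)) = if v = w then 1 else 0 := by
  induction v using descent_induction generalizing w with
  | one =>
    rw [permDivDiff_one, Module.End.one_apply, schubert_eq_killCompl, constantCoeff_killCompl,
      constantCoeff_doubleSchubert]
    simp only [eq_comm]
  | descent v i hi ih =>
    rw [permDivDiff_of_isDescent _ hi, adjDivDiff_schubert]
    by_cases hw : IsDescent w i
    · rw [if_pos hw, ih]
      simp only [mul_left_inj]
    · rw [if_neg hw, map_zero, map_zero, if_neg (ne_of_apply_ne (IsDescent · i) (by simp [hi, hw]))]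

end Schubert

section Shift

open FinPerm

theorem eq_C_of_adjDivDiff_eq_zero {f : MvPolynomial (ℕ ⊕ ℕ) ℤ}
    (hl : ∀ i, adjDivDiff Sum.inl_injective i f = 0)
    (hr : ∀ j, adjDivDiff Sum.inr_injective j f = 0) : f = C (constantCoeff f) := by
  refine vars_eq_empty_iff_eq_C.1 (Finset.eq_empty_of_forall_notMem ?_)
  rintro (i | j)
  · exact notMem_vars_of_adjDivDiff_eq_zero Sum.inl_injective hl i
  · exact notMem_vars_of_adjDivDiff_eq_zero Sum.inr_injective hr j

theorem eq_of_adjDivDiff_eq {f g : MvPolynomial (ℕ ⊕ ℕ) ℤ}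
    (h0 : constantCoeff f = constantCoeff g)
    (hl : ∀ i, adjDivDiff Sum.inl_injective i f = adjDivDiff Sum.inl_injective i g)
    (hr : ∀ j, adjDivDiff Sum.inr_injective j f = adjDivDiff Sum.inr_injective j g) : f = g := by
  rw [← sub_eq_zero, eq_C_of_adjDivDiff_eq_zero (f := f - g)
    (fun i => by rw [map_sub, hl, sub_self]) (fun j => by rw [map_sub, hr, sub_self]), map_sub, h0,
    sub_self, map_zero]

/-- The specialization that sets the first `n` variables `x` and the first `n` variables `y` to `0`
and renumbers the other ones by `x_{n+i} ↦ x_i` and `y_{n+j} ↦ y_j`. -/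
noncomputable def shiftVars (n : ℕ) : MvPolynomial (ℕ ⊕ ℕ) ℤ →ₐ[ℤ] MvPolynomial (ℕ ⊕ ℕ) ℤ :=
  killCompl ((add_right_injective n).sumMap (add_right_injective n))

theorem constantCoeff_shiftVars (n : ℕ) (f : MvPolynomial (ℕ ⊕ ℕ) ℤ) :
    constantCoeff (shiftVars n f) = constantCoeff f :=
  constantCoeff_killCompl _ f

theorem adjDivDiff_inl_shiftVars (n i : ℕ) (f : MvPolynomial (ℕ ⊕ ℕ) ℤ) :
    adjDivDiff Sum.inl_injective i (shiftVars n f) =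
      shiftVars n (adjDivDiff Sum.inl_injective (n + i) f) :=
  divDiff_killCompl ((add_right_injective n).sumMap (add_right_injective n)) (by simp) f

theorem adjDivDiff_inr_shiftVars (n j : ℕ) (f : MvPolynomial (ℕ ⊕ ℕ) ℤ) :
    adjDivDiff Sum.inr_injective j (shiftVars n f) =
      shiftVars n (adjDivDiff Sum.inr_injective (n + j) f) :=
  divDiff_killCompl ((add_right_injective n).sumMap (add_right_injective n)) (by simp) f

theorem permDivDiff_inl_shiftVars (n : ℕ) (w : FinPerm) (f : MvPolynomial (ℕ ⊕ ℕ) ℤ) :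
    permDivDiff Sum.inl_injective w (shiftVars n f) =
      shiftVars n (permDivDiff Sum.inl_injective (oneTimes n w) f) := by
  rw [permDivDiff_map (Sum.inl_injective.comp (add_right_injective n)) Sum.inl_injective
    (adjDivDiff_inl_shiftVars n), permDivDiff_comp_add]

theorem permDivDiff_inr_shiftVars (n : ℕ) (w : FinPerm) (f : MvPolynomial (ℕ ⊕ ℕ) ℤ) :
    permDivDiff Sum.inr_injective w (shiftVars n f) =
      shiftVars n (permDivDiff Sum.inr_injective (oneTimes n w) f) := by
  rw [permDivDiff_map (Sum.inr_injective.comp (add_right_injective n)) Sum.inr_injective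
    (adjDivDiff_inr_shiftVars n), permDivDiff_comp_add]

theorem shiftVars_doubleSchubert (n : ℕ) (w : FinPerm) :
    shiftVars n (doubleSchubert (oneTimes n w)) = doubleSchubert w := by
  classical
  induction hl : length w using Nat.strong_induction_on generalizing w with
  | _ l ih =>
    refine eq_of_adjDivDiff_eq ?_ (fun i => ?_) (fun j => ?_)
    · rw [constantCoeff_shiftVars, constantCoeff_doubleSchubert, constantCoeff_doubleSchubert]
      simp only [oneTimes_eq_one_iff]
    · rw [adjDivDiff_inl_shiftVars, adjDivDiff_inl_doubleSchubert, adjDivDiff_inl_doubleSchubert]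
      simp only [isDescent_oneTimes_add]
      split_ifs with hi
      · have := length_mul_simple w i hi
        rw [← oneTimes_simple, ← oneTimes_mul, ih _ (by omega) _ rfl]
      · exact map_zero _
    · rw [adjDivDiff_inr_shiftVars, adjDivDiff_inr_doubleSchubert, adjDivDiff_inr_doubleSchubert]
      simp only [oneTimes_inv, isDescent_oneTimes_add]
      split_ifs with hj
      · have := length_simple_mul hj
        rw [← oneTimes_simple, ← oneTimes_mul, map_neg, ih _ (by omega) _ rfl]
      · exact map_zero _

end Shift

section DualBasis

open FinPerm

/-- The coefficient of `𝔖_p` in the expansion of a polynomial in the products `𝔖_u(x) 𝔖_v(-y)`.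
The sign makes up for the substitution of `-y` in the second factor. -/
noncomputable def pairCoeff (p : FinPerm × FinPerm) : Module.Dual ℤ (MvPolynomial (ℕ ⊕ ℕ) ℤ) :=
  ((-1) ^ length p.2 : ℤ) • (lcoeff ℤ 0 ∘ₗ permDivDiff Sum.inl_injective p.1 ∘ₗ
    permDivDiff Sum.inr_injective p.2)

theorem pairCoeff_apply (p : FinPerm × FinPerm) (F : MvPolynomial (ℕ ⊕ ℕ) ℤ) :
    pairCoeff p F = (-1) ^ length p.2 * constantCoeff
      (permDivDiff Sum.inl_injective p.1 (permDivDiff Sum.inr_injective p.2 F)) :=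
  rfl

theorem permDivDiff_inl_rename_mul {g : MvPolynomial (ℕ ⊕ ℕ) ℤ}
    (hg : ∀ i : ℕ, rename (Equiv.swap (Sum.inl i) (Sum.inl (i + 1))) g = g) (w : FinPerm)
    (f : MvPolynomial ℕ ℤ) :
    permDivDiff Sum.inl_injective w (rename Sum.inl f * g) =
      rename Sum.inl (permDivDiff Function.injective_id w f) * g :=
  permDivDiff_map (σ := ℕ) (T := fun f => rename Sum.inl f * g) Function.injective_id
    Sum.inl_injective (fun i f =>
      (divDiff_mul_of_rename_eq (Sum.inl_injective.ne i.lt_succ_self.ne) (hg i) _).trans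
        (congrArg (· * g) (divDiff_rename Sum.inl_injective i.lt_succ_self.ne f))) w f

theorem permDivDiff_inr_aeval_neg_X_mul {g : MvPolynomial (ℕ ⊕ ℕ) ℤ}
    (hg : ∀ j : ℕ, rename (Equiv.swap (Sum.inr j) (Sum.inr (j + 1))) g = g) (w : FinPerm)
    (f : MvPolynomial ℕ ℤ) :
    permDivDiff Sum.inr_injective w (aeval (fun j => -X (Sum.inr j)) f * g) =
      (-1 : ℤ) ^ length w •
        (aeval (fun j => -X (Sum.inr j)) (permDivDiff Function.injective_id w f) * g) :=
  permDivDiff_map_of_eq_smul (σ := ℕ) (T := fun f => aeval (fun j => -X (Sum.inr j)) f * g)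
    Function.injective_id Sum.inr_injective (fun j f =>
      (divDiff_mul_of_rename_eq (Sum.inr_injective.ne j.lt_succ_self.ne) (hg j) _).trans (by
        rw [divDiff_aeval_neg_X Sum.inr_injective j.lt_succ_self.ne, neg_mul, neg_one_smul]
        rfl)) w f

theorem rename_swap_inr_rename_inl (j : ℕ) (f : MvPolynomial ℕ ℤ) :
    rename (Equiv.swap (Sum.inr j) (Sum.inr (j + 1))) (rename Sum.inl f) =
      (rename Sum.inl f : MvPolynomial (ℕ ⊕ ℕ) ℤ) := by
  rw [rename_rename]
  congr 2

theorem rename_swap_inl_aeval_neg_X (i : ℕ) (f : MvPolynomial ℕ ℤ) :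
    rename (Equiv.swap (Sum.inl i) (Sum.inl (i + 1))) (aeval (fun j => -X (Sum.inr j)) f) =
      (aeval (fun j => -X (Sum.inr j)) f : MvPolynomial (ℕ ⊕ ℕ) ℤ) := by
  rw [← AlgHom.comp_apply, comp_aeval]
  simp [Equiv.swap_apply_of_ne_of_ne]

theorem constantCoeff_aeval_neg_X (f : MvPolynomial ℕ ℤ) :
    constantCoeff (aeval (fun j => -X (Sum.inr j)) f : MvPolynomial (ℕ ⊕ ℕ) ℤ) =
      constantCoeff f := by
  refine DFunLike.congr_fun (f := (constantCoeff : MvPolynomial (ℕ ⊕ ℕ) ℤ →+* ℤ).comp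
    (aeval fun j => -X (Sum.inr j) : MvPolynomial ℕ ℤ →ₐ[ℤ] MvPolynomial (ℕ ⊕ ℕ) ℤ).toRingHom) ?_ f
  ext <;> simp

theorem pairCoeff_rename_mul_aeval (p : FinPerm × FinPerm) (f g : MvPolynomial ℕ ℤ) :
    pairCoeff p (rename Sum.inl f * aeval (fun j => -X (Sum.inr j)) g) =
      constantCoeff (permDivDiff Function.injective_id p.1 f) *
        constantCoeff (permDivDiff Function.injective_id p.2 g) := by
  rw [pairCoeff_apply, mul_comm (rename _ _),
    permDivDiff_inr_aeval_neg_X_mul (rename_swap_inr_rename_inl · f), map_smul,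
    mul_comm (aeval _ _), permDivDiff_inl_rename_mul (rename_swap_inl_aeval_neg_X · _),
    smul_eq_C_mul, map_mul, map_mul, constantCoeff_C, constantCoeff_rename,
    constantCoeff_aeval_neg_X, ← mul_assoc, ← mul_pow, neg_one_mul, neg_neg, one_pow, one_mul]

open Classical in
theorem pairCoeff_schubertPair (p q : FinPerm × FinPerm) :
    pairCoeff p (schubertPair q) = if p = q then 1 else 0 := by
  rw [schubertPair, pairCoeff_rename_mul_aeval, constantCoeff_permDivDiff_schubert,
    constantCoeff_permDivDiff_schubert, ite_zero_mul_ite_zero, one_mul]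
  simp only [Prod.ext_iff]

theorem pairCoeff_adjDivDiff_inl (p : FinPerm × FinPerm) (i : ℕ) (F : MvPolynomial (ℕ ⊕ ℕ) ℤ) :
    pairCoeff p (adjDivDiff Sum.inl_injective i F) =
      if IsDescent p.1 i then 0 else pairCoeff (p.1 * simple i, p.2) F := by
  have commute := adjDivDiff_commute_permDivDiff (σ := ℕ ⊕ ℕ) Sum.inl_injective Sum.inr_injective
    (fun _ _ => Sum.inl_ne_inr) i p.2
  rw [pairCoeff_apply, ← Module.End.mul_apply (permDivDiff _ p.2), ← commute.eq,
    Module.End.mul_apply, ← Module.End.mul_apply, permDivDiff_mul_adjDivDiff]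
  split_ifs
  · rw [LinearMap.zero_apply, map_zero, mul_zero]
  · rfl

theorem pairCoeff_adjDivDiff_inr (p : FinPerm × FinPerm) (j : ℕ) (F : MvPolynomial (ℕ ⊕ ℕ) ℤ) :
    pairCoeff p (adjDivDiff Sum.inr_injective j F) =
      if IsDescent p.2 j then 0 else -pairCoeff (p.1, p.2 * simple j) F := by
  rw [pairCoeff_apply, ← Module.End.mul_apply (permDivDiff _ p.2), permDivDiff_mul_adjDivDiff]
  split_ifs with hj
  · rw [LinearMap.zero_apply, map_zero, map_zero, mul_zero]
  · rw [pairCoeff_apply, length_mul_simple_of_not_isDescent hj, pow_succ]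
    ring

theorem eq_zero_of_pairCoeff_eq_zero {F : MvPolynomial (ℕ ⊕ ℕ) ℤ}
    (h : ∀ p, pairCoeff p F = 0) : F = 0 := by
  induction hd : F.totalDegree using Nat.strong_induction_on generalizing F with
  | _ d ih =>
    have inl_eq_zero : ∀ i, adjDivDiff Sum.inl_injective i F = 0 := fun i => by
      by_contra hne
      refine hne (ih _ (hd ▸ totalDegree_adjDivDiff_lt Sum.inl_injective hne) (fun p => ?_) rfl)
      rw [pairCoeff_adjDivDiff_inl, h, ite_self]
    have inr_eq_zero : ∀ j, adjDivDiff Sum.inr_injective j F = 0 := fun j => by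
      by_contra hne
      refine hne (ih _ (hd ▸ totalDegree_adjDivDiff_lt Sum.inr_injective hne) (fun p => ?_) rfl)
      rw [pairCoeff_adjDivDiff_inr, h, neg_zero, ite_self]
    have h_one := h 1
    rw [pairCoeff_apply, Prod.fst_one, Prod.snd_one, length_one, pow_zero, one_mul,
      permDivDiff_one, permDivDiff_one, Module.End.one_apply, Module.End.one_apply] at h_one
    rw [eq_C_of_adjDivDiff_eq_zero inl_eq_zero inr_eq_zero, h_one, C_0]

theorem finite_setOf_pairCoeff_ne_zero (F : MvPolynomial (ℕ ⊕ ℕ) ℤ) :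
    {p | pairCoeff p F ≠ 0}.Finite := by
  refine ((finite_setOf_permDivDiff_ne_zero Sum.inr_injective F).biUnion fun v _ =>
    (finite_setOf_permDivDiff_ne_zero Sum.inl_injective
      (permDivDiff Sum.inr_injective v F)).image fun u => (u, v)).subset ?_
  rintro ⟨u, v⟩ hp
  have hu : permDivDiff Sum.inl_injective u (permDivDiff Sum.inr_injective v F) ≠ 0 := fun h0 =>
    hp (by rw [pairCoeff_apply, h0, map_zero, mul_zero])
  exact Set.mem_biUnion (Set.mem_ofPred.2 (ne_zero_of_map hu)) ⟨u, hu, rfl⟩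

theorem dualBases_schubertPair : Module.DualBases schubertPair pairCoeff where
  eval_same p := (pairCoeff_schubertPair p p).trans (if_pos rfl)
  eval_of_ne p q hpq := (pairCoeff_schubertPair p q).trans (if_neg hpq)
  total h := sub_eq_zero.1 (eq_zero_of_pairCoeff_eq_zero fun p => by rw [map_sub, h p, sub_self])
  finite := finite_setOf_pairCoeff_ne_zero

theorem pairCoeff_shiftVars (n : ℕ) (p : FinPerm × FinPerm) (F : MvPolynomial (ℕ ⊕ ℕ) ℤ) :
    pairCoeff p (shiftVars n F) = pairCoeff (oneTimesPair n p) F := by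
  rw [pairCoeff_apply, permDivDiff_inr_shiftVars, permDivDiff_inl_shiftVars,
    constantCoeff_shiftVars, pairCoeff_apply, oneTimesPair, length_oneTimes]

theorem pairCoeff_eq_zero_of_apply_zero_ne {F : MvPolynomial (ℕ ⊕ ℕ) ℤ} {n : ℕ}
    (hF : F.totalDegree < n) (hl : ∀ i, i + 1 < n → adjDivDiff Sum.inl_injective i F = 0)
    (hr : ∀ j, j + 1 < n → adjDivDiff Sum.inr_injective j F = 0) {p : FinPerm × FinPerm}
    (hp : p.1.1 0 ≠ 0 ∨ p.2.1 0 ≠ 0) : pairCoeff p F = 0 := by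
  suffices permDivDiff Sum.inl_injective p.1 (permDivDiff Sum.inr_injective p.2 F) = 0 by
    rw [pairCoeff_apply, this, map_zero, mul_zero]
  rcases hp with hp | hp
  · have commute := permDivDiff_commute (σ := ℕ ⊕ ℕ) Sum.inl_injective Sum.inr_injective
      (fun _ _ => Sum.inl_ne_inr) p.1 p.2
    rw [← Module.End.mul_apply, commute.eq, Module.End.mul_apply,
      permDivDiff_eq_zero_of_apply_zero_ne Sum.inl_injective hp hF hl, map_zero]
  · rw [permDivDiff_eq_zero_of_apply_zero_ne Sum.inr_injective hp hF hr, map_zero]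

end DualBasis

section Stability

open FinPerm

theorem oneTimesPair_injective (n : ℕ) : Function.Injective (oneTimesPair n) :=
  (oneTimes_injective n).prodMap (oneTimes_injective n)

theorem oneTimesPair_zero (p : FinPerm × FinPerm) : oneTimesPair 0 p = p :=
  Prod.ext (oneTimes_zero _) (oneTimes_zero _)

theorem oneTimesPair_oneTimesPair (m n : ℕ) (p : FinPerm × FinPerm) :
    oneTimesPair m (oneTimesPair n p) = oneTimesPair (m + n) p :=
  Prod.ext (oneTimes_oneTimes _ _ _) (oneTimes_oneTimes _ _ _)

theorem exists_eq_oneTimesPair_one {p : FinPerm × FinPerm} (h₁ : p.1.1 0 = 0) (h₂ : p.2.1 0 = 0) :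
    ∃ q, p = oneTimesPair 1 q := by
  obtain ⟨u, hu⟩ := exists_eq_oneTimes_one h₁
  obtain ⟨v, hv⟩ := exists_eq_oneTimes_one h₂
  exact ⟨(u, v), Prod.ext hu hv⟩

/-- A sequence of coefficient families in which the coefficient of `1 × p` at stage `n + 1` is the
coefficient of `p` at stage `n`. -/
def IsShiftStable (c : ℕ → (FinPerm × FinPerm →₀ ℤ)) : Prop :=
  ∀ n p, c (n + 1) (oneTimesPair 1 p) = c n p

namespace IsShiftStable

variable {c : ℕ → (FinPerm × FinPerm →₀ ℤ)}

theorem apply_zero_ne_of_mem_newPairs (hc : IsShiftStable c) {n : ℕ} {p : FinPerm × FinPerm}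
    (hp : p ∈ newPairs c (n + 1)) : p.1.1 0 ≠ 0 ∨ p.2.1 0 ≠ 0 := by
  classical
  by_contra! h
  obtain ⟨q, rfl⟩ := exists_eq_oneTimesPair_one h.1 h.2
  obtain ⟨hsupp, hnew⟩ := Finset.mem_sdiff.1 hp
  rw [Finsupp.mem_support_iff, hc n q, ← Finsupp.mem_support_iff] at hsupp
  exact hnew (Finset.mem_image_of_mem _ hsupp)

variable {M : Type*} [AddCommGroup M]

theorem sum_support_succ (hc : IsShiftStable c) (n : ℕ) (g : FinPerm × FinPerm → M) :
    ∑ p ∈ (c (n + 1)).support, c (n + 1) p • g p =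
      ∑ p ∈ (c n).support, c n p • g (oneTimesPair 1 p) +
        ∑ p ∈ newPairs c (n + 1), c (n + 1) p • g p := by
  classical
  have image_subset : (c n).support.image (oneTimesPair 1) ⊆ (c (n + 1)).support := by
    refine Finset.image_subset_iff.2 fun p hp => ?_
    rwa [Finsupp.mem_support_iff, hc n p, ← Finsupp.mem_support_iff]
  rw [← Finset.sum_sdiff image_subset, add_comm,
    Finset.sum_image (oneTimesPair_injective 1).injOn, newPairs]
  simp only [hc n]

theorem sum_support_eq_sum_newPairs (hc : IsShiftStable c) (n : ℕ) (g : FinPerm × FinPerm → M) :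
    ∑ p ∈ (c n).support, c n p • g p =
      ∑ i ∈ Finset.range (n + 1), ∑ p ∈ newPairs c i, c i p • g (oneTimesPair (n - i) p) := by
  induction n generalizing g with
  | zero => simp [newPairs, oneTimesPair_zero]
  | succ n ih =>
    rw [hc.sum_support_succ, ih, Finset.sum_range_succ _ (n + 1), Nat.sub_self]
    simp only [oneTimesPair_zero, oneTimesPair_oneTimesPair]
    congr 1
    refine Finset.sum_congr rfl fun i hi => ?_
    rw [← Nat.add_sub_assoc (Finset.mem_range_succ_iff.1 hi), add_comm 1]

end IsShiftStable

variable {ι : Type*} [Fintype ι] (w : ι → FinPerm)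

/-- The coefficients of `∏_t 𝔖_{1^n × w_t}(x, y)` in the basis of the products `𝔖_u(x) 𝔖_v(-y)`. -/
noncomputable def productExpansion (n : ℕ) : FinPerm × FinPerm →₀ ℤ :=
  dualBases_schubertPair.coeffs (∏ t, doubleSchubert (oneTimes n (w t)))

theorem productExpansion_apply (n : ℕ) (p : FinPerm × FinPerm) :
    productExpansion w n p = pairCoeff p (∏ t, doubleSchubert (oneTimes n (w t))) :=
  rfl

theorem prod_doubleSchubert_eq_sum_iff (n : ℕ) (d : FinPerm × FinPerm →₀ ℤ) :
    ∏ t, doubleSchubert (oneTimes n (w t)) = (d.sum fun p a => a • schubertPair p) ↔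
      d = productExpansion w n :=
  ⟨fun h => by rw [productExpansion, h]; exact (dualBases_schubertPair.coeffs_lc d).symm,
    fun h => h ▸ (dualBases_schubertPair.lc_coeffs _).symm⟩

theorem prod_doubleSchubert_eq_sum_support (n : ℕ) :
    ∏ t, doubleSchubert (oneTimes n (w t)) =
      ∑ p ∈ (productExpansion w n).support, productExpansion w n p • schubertPair p :=
  (prod_doubleSchubert_eq_sum_iff w n _).2 rfl

theorem isShiftStable_productExpansion : IsShiftStable (productExpansion w) := fun n p => by
  rw [productExpansion_apply, productExpansion_apply, ← pairCoeff_shiftVars, map_prod]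
  simp only [add_comm n, ← oneTimes_oneTimes, shiftVars_doubleSchubert]

theorem isHomogeneous_prod_doubleSchubert (n : ℕ) :
    (∏ t, doubleSchubert (oneTimes n (w t))).IsHomogeneous (∑ t, length (w t)) :=
  IsHomogeneous.prod _ _ _ fun t _ => length_oneTimes n (w t) ▸ isHomogeneous_doubleSchubert _

theorem adjDivDiff_inl_prod_doubleSchubert {n i : ℕ} (h : i + 1 < n) :
    adjDivDiff Sum.inl_injective i (∏ t, doubleSchubert (oneTimes n (w t))) = 0 :=
  adjDivDiff_prod_eq_zero Sum.inl_injective fun t _ => by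
    rw [adjDivDiff_inl_doubleSchubert, if_neg (not_isDescent_oneTimes _ h)]

theorem adjDivDiff_inr_prod_doubleSchubert {n j : ℕ} (h : j + 1 < n) :
    adjDivDiff Sum.inr_injective j (∏ t, doubleSchubert (oneTimes n (w t))) = 0 :=
  adjDivDiff_prod_eq_zero Sum.inr_injective fun t _ => by
    rw [adjDivDiff_inr_doubleSchubert, oneTimes_inv, if_neg (not_isDescent_oneTimes _ h)]

theorem newPairs_productExpansion_eq_empty {n : ℕ} (hn : ∑ t, length (w t) < n) :
    newPairs (productExpansion w) n = ∅ := by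
  classical
  obtain ⟨m, rfl⟩ := Nat.exists_eq_add_one_of_ne_zero hn.ne_bot
  refine Finset.eq_empty_of_forall_notMem fun p hp => ?_
  refine Finsupp.mem_support_iff.1 (Finset.mem_sdiff.1 hp).1 ?_
  exact pairCoeff_eq_zero_of_apply_zero_ne
    ((isHomogeneous_prod_doubleSchubert w _).totalDegree_le.trans_lt hn)
    (fun _ => adjDivDiff_inl_prod_doubleSchubert w) (fun _ => adjDivDiff_inr_prod_doubleSchubert w)
    ((isShiftStable_productExpansion w).apply_zero_ne_of_mem_newPairs hp)

end Stability

theorem mainTheorem8 (r : ℕ) (w : Fin r → FinPerm) :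
    ∃ c : ℕ → (FinPerm × FinPerm →₀ ℤ),
      -- `c n` is the unique expansion of the product for `1^n × w₁, …, 1^n × w_r`
      (∀ (n : ℕ) (d : FinPerm × FinPerm →₀ ℤ),
        (∏ t, doubleSchubert (FinPerm.oneTimes n (w t)) = d.sum fun p a => a • schubertPair p) ↔
          d = c n) ∧
      -- passing from `n` to `n + 1`
      (∀ n : ℕ,
        (∏ t, doubleSchubert (FinPerm.oneTimes (n + 1) (w t)) =
          ∑ p ∈ (c n).support, c n p • schubertPair (oneTimesPair 1 p) +
          ∑ p ∈ newPairs c (n + 1), c (n + 1) p • schubertPair p) ∧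
        ∀ p ∈ newPairs c (n + 1), p.1.1 0 ≠ 0 ∨ p.2.1 0 ≠ 0) ∧
      -- stabilization from `n = k` on
      (∀ n : ℕ, (∑ t, FinPerm.length (w t)) ≤ n →
        ∏ t, doubleSchubert (FinPerm.oneTimes n (w t)) =
          ∑ i ∈ Finset.range ((∑ t, FinPerm.length (w t)) + 1),
            ∑ p ∈ newPairs c i, c i p • schubertPair (oneTimesPair (n - i) p)) := by
  have stable := isShiftStable_productExpansion w
  refine ⟨productExpansion w, prod_doubleSchubert_eq_sum_iff w, fun n => ⟨?_, fun p hp => ?_⟩,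
    fun n hn => ?_⟩
  · rw [prod_doubleSchubert_eq_sum_support, stable.sum_support_succ]
  · exact stable.apply_zero_ne_of_mem_newPairs hp
  · rw [prod_doubleSchubert_eq_sum_support, stable.sum_support_eq_sum_newPairs]
    refine (Finset.sum_subset (Finset.range_mono (Nat.succ_le_succ hn)) fun i _ hi => ?_).symm
    rw [newPairs_productExpansion_eq_empty w (by simpa using hi), Finset.sum_empty]
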